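/- Proposition 2.7. Let $p$ be a prime, let $\mathbb{C}_p$ be the completion of an algebraic closure of $\mathbb{Q}_p$, and let $\mathfrak{m}_{\mathbb{C}_p}\subset\mathbb{C}_p$ be the open unit disc. Let $S_0(\mathbb{Z}_p)$ be the monoid, under composition, of formal power series over $\mathbb{Z}_p$ without constant term, with the topology of coefficientwise $p$-adic convergence. Let $f,u\in S_0(\mathbb{Z}_p)$ satisfy: 1. $f\circ u=u\circ f$; 2. $u$ is invertible under composition and has infinite order; 3. $v_p(f'(0))=1$ and $f$ has exactly $p$ roots in $\mathfrak{m}_{\mathbb{C}_p}$; 4. $v_p(1-u'(0)^m)=v_p(1-u'(0))+v_p(m)$ for all integers $m\ge 0$. An $f$-consistent sequence is a sequence $(s_1,s_2,s_3,\dots)$ of elements of $\mathfrak{m}_{\mathbb{C}_p}$ such that $f(s_1)=0$ and $f(s_i)=s_{i-1}$ for $i>1$. Fix an $f$-consistent sequence $\Pi=(\pi_1,\pi_2,\dots)$ with $\pi_1\neq 0$. Then there is a largest integer $k\ge 1$ with $u(\pi_k)=\pi_k$. For this $k$, let $\mathcal{T}_{\pi_k}$ be the set of all $f$-consistent sequences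 $(s_1,s_2,\dots)$ with $s_i=\pi_i$ for $i\le k$, and let $u^{\circ\mathbb{Z}_p}$ be the closed subgroup of $S_0(\mathbb{Z}_p)$ generated by $u$, that is, the closure of $\{u^{\circ n}:n\in\mathbb{Z}\}$ in the group of invertible elements. Then the rule $g\cdot(s_1,s_2,\dots)=(g(s_1),g(s_2),\dots)$ defines an action of $u^{\circ\mathbb{Z}_p}$ on $\mathcal{T}_{\pi_k}$, and $\mathcal{T}_{\pi_k}$ is a torsor for $u^{\circ\mathbb{Z}_p}$: it is nonempty and the action is free and transitive. -/

import Mathlib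

open scoped PowerSeries

/-- `S₀(R)`: the formal power series over `R` without constant term. -/
def S0 (R : Type*) [CommRing R] : Type _ :=
  {g : R⟦X⟧ // PowerSeries.constantCoeff g = 0}

namespace S0

section Monoid

variable {R : Type*} [CommRing R]

theorem hasSubst (g : S0 R) : PowerSeries.HasSubst g.1 :=
  PowerSeries.HasSubst.of_constantCoeff_zero' g.2

theorem coeff_pow_eq_zero (g : S0 R) {n i : ℕ} (h : n < i) :
    PowerSeries.coeff n (g.1 ^ i) = 0 := by
  have h1 : (PowerSeries.X : R⟦X⟧) ∣ g.1 := PowerSeries.X_dvd_iff.mpr g.2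
  exact PowerSeries.X_pow_dvd_iff.mp (pow_dvd_pow_of_dvd h1 i) n h

theorem coeff_subst_eq_sum (f : R⟦X⟧) (g : S0 R) (n : ℕ) :
    PowerSeries.coeff n (f.subst g.1) =
      ∑ i ∈ Finset.range (n + 1), PowerSeries.coeff i f * PowerSeries.coeff n (g.1 ^ i) := by
  rw [PowerSeries.coeff_subst' g.hasSubst]
  refine finsum_eq_sum_of_support_subset _ fun i hi => ?_
  by_contra hni
  refine hi ?_
  have : n < i := by simpa using hni
  simp [coeff_pow_eq_zero g this]

/-- The composition `f ∘ g`, i.e. `f(g(x))`. -/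
noncomputable instance : Mul (S0 R) where
  mul f g := ⟨f.1.subst g.1, by
    rw [← PowerSeries.coeff_zero_eq_constantCoeff_apply, coeff_subst_eq_sum]
    simp [f.2]⟩

/-- The identity for composition is the series `x`. -/
noncomputable instance : One (S0 R) where
  one := ⟨PowerSeries.X, by simp⟩

theorem val_mul (f g : S0 R) : (f * g).1 = f.1.subst g.1 := rfl

theorem val_one : (1 : S0 R).1 = PowerSeries.X := rfl

/-- Power series without constant term form a monoid under composition. -/
noncomputable instance : Monoid (S0 R) where
  mul_assoc f g h := Subtype.ext <| by
    simp only [val_mul]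
    exact PowerSeries.subst_comp_subst_apply g.hasSubst h.hasSubst f.1
  one_mul f := Subtype.ext <| by
    simp only [val_mul, val_one]
    exact PowerSeries.subst_X f.hasSubst
  mul_one f := Subtype.ext <| by
    simp only [val_mul, val_one]
    exact PowerSeries.X_subst f.1

end Monoid

section Topology

variable {R : Type*} [CommRing R] [TopologicalSpace R]

open scoped PowerSeries.WithPiTopology in
/-- The topology of coefficientwise convergence. -/
instance : TopologicalSpace (S0 R) :=
  inferInstanceAs (TopologicalSpace {g : R⟦X⟧ // PowerSeries.constantCoeff g = 0})

open scoped PowerSeries.WithPiTopology in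
/-- Composition is jointly continuous. -/
instance [IsTopologicalRing R] : ContinuousMul (S0 R) where
  continuous_mul := by
    have hval : Continuous (Subtype.val : S0 R → R⟦X⟧) := continuous_subtype_val
    have h1 : Continuous fun q : S0 R × S0 R => q.1.1 := hval.comp continuous_fst
    have h2 : Continuous fun q : S0 R × S0 R => q.2.1 := hval.comp continuous_snd
    refine continuous_induced_rng.mpr (continuous_iff_continuousAt.mpr fun x => ?_)
    refine (PowerSeries.WithPiTopology.tendsto_iff_coeff_tendsto R _ _ _).mpr fun d => ?_
    have h3 : Continuous fun q : S0 R × S0 R =>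
        ∑ i ∈ Finset.range (d + 1),
          PowerSeries.coeff i q.1.1 * PowerSeries.coeff d (q.2.1 ^ i) :=
      continuous_finsetSum _ fun i _ =>
        ((PowerSeries.WithPiTopology.continuous_coeff R i).comp h1).mul
          ((PowerSeries.WithPiTopology.continuous_coeff R d).comp (h2.pow i))
    have h4 : (fun q : S0 R × S0 R => PowerSeries.coeff d (q.1 * q.2).1) = fun q =>
        ∑ i ∈ Finset.range (d + 1),
          PowerSeries.coeff i q.1.1 * PowerSeries.coeff d (q.2.1 ^ i) :=
      funext fun q => coeff_subst_eq_sum _ _ _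
    exact (h4 ▸ h3).tendsto x

end Topology

end S0

section Padic

variable {p : ℕ} [Fact p.Prime]

/-- The value `g(x)` of `g ∈ ℤ_p⟦X⟧` at a point `x` of `ℂ_p`; the series converges when `‖x‖ < 1`. -/
noncomputable def evalCp (g : ℤ_[p]⟦X⟧) (x : ℂ_[p]) : ℂ_[p] :=
  ∑' n : ℕ, algebraMap ℚ_[p] ℂ_[p] (PowerSeries.coeff n g : ℤ_[p]) * x ^ n

theorem summable_evalCp (g : ℤ_[p]⟦X⟧) {x : ℂ_[p]} (hx : ‖x‖ < 1) :
    Summable fun n : ℕ => algebraMap ℚ_[p] ℂ_[p] (PowerSeries.coeff n g : ℤ_[p]) * x ^ n := by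
  refine Summable.of_norm_bounded (summable_geometric_of_lt_one (norm_nonneg x) hx) fun n => ?_
  rw [norm_mul, norm_pow, norm_algebraMap']
  exact mul_le_of_le_one_left (by positivity) (PadicInt.norm_le_one _)

/-- An `f`-consistent sequence `(s₁, s₂, s₃, …)` of points of the open unit disc of `ℂ_p`:
`f(s₁) = 0` and `f(sᵢ₊₁) = sᵢ` for all `i ≥ 1`. -/
structure IsConsistent (f : ℤ_[p]⟦X⟧) (s : ℕ+ → ℂ_[p]) : Prop where
  norm_lt_one : ∀ i, ‖s i‖ < 1
  eval_one : evalCp f (s 1) = 0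
  eval_succ : ∀ i, evalCp f (s (i + 1)) = s i

/-- The `f`-consistent sequences that agree with `π` in the first `k` terms. -/
def consistentAgreeing (f : ℤ_[p]⟦X⟧) (π : ℕ+ → ℂ_[p]) (k : ℕ+) : Set (ℕ+ → ℂ_[p]) :=
  {s | IsConsistent f s ∧ ∀ i ≤ k, s i = π i}

end Padic

/-!
The argument replaces counting of fixed points by divisibility in `ℤ_p⟦X⟧`.

Write `f = X * h`. Then `f^{∘(n+1)} = f^{∘n} * h(f^{∘n})`, and each factor `h(f^{∘n})` has constant
term `f'(0)`, a uniformizer, and is nonzero modulo `p`; so it is a unit times an Eisenstein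
polynomial (`exists_irreducible_factorization`). Hence its zeros are simple, and it divides every
series over `ℤ_p` that vanishes at one of them (`dvd_of_common_zero`). With exactly `p` roots this
gives `f` Weierstrass degree `p` (`isHeightOne_of_ncard_zeros`), and a series that vanishes at
`0, π₁, …, π_n` is divisible by `f^{∘n}` (`IsTower.pow_dvd`).

Let `k` be maximal such that `u` fixes `π_k`, with `π_0 = 0`. Then
`u - X = p ^ a * f^{∘k} * unit`: a zero of the cofactor would be a fixed point of `u`, hence a zero
of some iterate of `f`, hence either conjugate to some `π_j` with `j > k`, or a double zero of
`u - X`, which the chain rule for `f ∘ u = u ∘ f` excludes as `u'(0) ≠ 1`. So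
`v(1 - u'(0)) = a + k` (`exists_norm_linearCoeff_sub_one`). If `u^{∘N}` fixes `π_{k+m}`, then
`p ^ a * f^{∘(k+m)}` divides `u^{∘N} - X`, so `v(1 - u'(0)^N) ≥ a + k + m`, and the hypothesis on
these valuations gives `p ^ m ∣ N` (`pow_dvd_of_fixed`).

Thus the `u`-orbit of `π_{k+m}` has at least `p ^ m` points, while the fibre of `f^{∘m}` over `π_k`
has at most `p ^ m` (`card_fibre_le`), so the orbit is the fibre (`exists_pow_eq`). The case
`k = 0`, `m = 1` is absurd, as `0` is in the fibre, so `k ≥ 1`. Compactness of the closed subgroup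
generated by `u` turns transitivity at each finite level into transitivity on sequences
(`exists_mem_closure_forall_eq`), and the action is free because a nonzero series over `ℤ_p` has
finitely many zeros in the open unit disc (`IsTower.eq_one_of_fixed`).
-/

open scoped PowerSeries

namespace PadicDynamics

variable {p : ℕ} [Fact p.Prime]

/-! ### Evaluation of power series on the open unit disc -/

/-- The embedding of `ℤ_p` into `ℂ_p`. -/
noncomputable def intCp : ℤ_[p] →+* ℂ_[p] :=
  (algebraMap ℚ_[p] ℂ_[p]).comp (algebraMap ℤ_[p] ℚ_[p])

theorem norm_intCp (a : ℤ_[p]) : ‖intCp a‖ = ‖a‖ := by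
  rw [intCp, RingHom.comp_apply, norm_algebraMap', PadicInt.algebraMap_apply, PadicInt.norm_def]

theorem intCp_injective : Function.Injective (intCp : ℤ_[p] →+* ℂ_[p]) := by
  refine (injective_iff_map_eq_zero _).mpr fun a ha => ?_
  rw [← norm_eq_zero, ← norm_intCp, ha, norm_zero]

theorem evalCp_eq_tsum (g : ℤ_[p]⟦X⟧) (x : ℂ_[p]) :
    evalCp g x = ∑' n, intCp (PowerSeries.coeff n g) * x ^ n := rfl

theorem norm_intCp_mul_pow_le (a : ℤ_[p]) (x : ℂ_[p]) (n : ℕ) :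
    ‖intCp a * x ^ n‖ ≤ ‖x‖ ^ n := by
  rw [norm_mul, norm_pow, norm_intCp]
  exact mul_le_of_le_one_left (by positivity) (PadicInt.norm_le_one _)

theorem summable_norm_intCp_mul_pow (g : ℤ_[p]⟦X⟧) {x : ℂ_[p]} (hx : ‖x‖ < 1) :
    Summable fun n => ‖intCp (PowerSeries.coeff n g) * x ^ n‖ :=
  Summable.of_nonneg_of_le (fun _ => norm_nonneg _) (fun n => norm_intCp_mul_pow_le _ _ n)
    (summable_geometric_of_lt_one (norm_nonneg x) hx)

/-- Evaluation at a point of the open unit disc, as a ring homomorphism. -/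
noncomputable def evalHom (x : ℂ_[p]) (hx : ‖x‖ < 1) : ℤ_[p]⟦X⟧ →+* ℂ_[p] where
  toFun g := evalCp g x
  map_one' := by
    rw [evalCp_eq_tsum, tsum_eq_single 0]
    · simp
    · intro n hn
      simp [PowerSeries.coeff_one, hn]
  map_zero' := by simp [evalCp_eq_tsum]
  map_add' f g := by
    simp only [evalCp_eq_tsum, map_add, add_mul]
    exact (summable_norm_intCp_mul_pow f hx).of_norm.tsum_add
      (summable_norm_intCp_mul_pow g hx).of_norm
  map_mul' f g := by
    simp only [evalCp_eq_tsum]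
    rw [tsum_mul_tsum_eq_tsum_sum_antidiagonal_of_summable_norm
      (summable_norm_intCp_mul_pow f hx) (summable_norm_intCp_mul_pow g hx)]
    refine tsum_congr fun n => ?_
    rw [PowerSeries.coeff_mul, map_sum, Finset.sum_mul]
    refine Finset.sum_congr rfl fun ij hij => ?_
    rw [← Finset.HasAntidiagonal.mem_antidiagonal.mp hij, map_mul, pow_add]
    ring

section Evaluation

variable {x : ℂ_[p]} (hx : ‖x‖ < 1)

theorem evalHom_apply (g : ℤ_[p]⟦X⟧) : evalHom x hx g = evalCp g x := rfl

theorem evalHom_C (a : ℤ_[p]) : evalHom x hx (PowerSeries.C a) = intCp a := by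
  rw [evalHom_apply, evalCp_eq_tsum, tsum_eq_single 0]
  · simp
  · intro n hn
    simp [PowerSeries.coeff_C, hn]

theorem evalHom_X : evalHom x hx PowerSeries.X = x := by
  rw [evalHom_apply, evalCp_eq_tsum, tsum_eq_single 1]
  · simp
  · intro n hn
    simp [PowerSeries.coeff_X, hn]

theorem evalHom_coe (P : Polynomial ℤ_[p]) : evalHom x hx P = P.eval₂ intCp x := by
  induction P using Polynomial.induction_on' with
  | add P Q hP hQ => rw [Polynomial.coe_add, map_add, hP, hQ, Polynomial.eval₂_add]
  | monomial n a =>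
    rw [← Polynomial.C_mul_X_pow_eq_monomial, Polynomial.coe_mul, Polynomial.coe_pow,
      Polynomial.coe_C, Polynomial.coe_X, map_mul, map_pow, evalHom_C,
      evalHom_X, Polynomial.eval₂_mul, Polynomial.eval₂_C, Polynomial.eval₂_X_pow]

theorem evalCp_zero_point (g : ℤ_[p]⟦X⟧) :
    evalCp g 0 = intCp (PowerSeries.constantCoeff g) := by
  rw [evalCp_eq_tsum, tsum_eq_single 0]
  · simp
  · intro n hn
    simp [hn]

theorem norm_evalHom_le (g : ℤ_[p]⟦X⟧) : ‖evalHom x hx g‖ ≤ 1 := by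
  rw [evalHom_apply, evalCp_eq_tsum]
  exact IsUltrametricDist.norm_tsum_le_of_forall_le_of_nonneg zero_le_one fun n =>
    (norm_intCp_mul_pow_le _ _ n).trans (pow_le_one₀ (norm_nonneg _) hx.le)

theorem exists_eq_C_add_X_mul {R : Type*} [CommRing R] (g : R⟦X⟧) :
    ∃ g' : R⟦X⟧, g = PowerSeries.C (PowerSeries.constantCoeff g) + PowerSeries.X * g' := by
  obtain ⟨g', hg'⟩ := PowerSeries.X_dvd_iff.mpr
    (show PowerSeries.constantCoeff (g - PowerSeries.C (PowerSeries.constantCoeff g)) = 0 by simp)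
  exact ⟨g', by rw [← hg']; ring⟩

theorem norm_evalHom_lt_one {g : ℤ_[p]⟦X⟧} (hg : ‖PowerSeries.constantCoeff g‖ < 1) :
    ‖evalHom x hx g‖ < 1 := by
  obtain ⟨g', hg'⟩ := exists_eq_C_add_X_mul g
  rw [hg', map_add, map_mul, evalHom_C, evalHom_X]
  refine (IsUltrametricDist.norm_add_le_max _ _).trans_lt (max_lt ?_ ?_)
  · rwa [norm_intCp]
  · rw [norm_mul]
    exact (mul_le_of_le_one_right (norm_nonneg _) (norm_evalHom_le hx g')).trans_lt hx

theorem evalHom_ne_zero_of_isUnit {g : ℤ_[p]⟦X⟧} (hg : IsUnit g) : evalHom x hx g ≠ 0 :=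
  (hg.map (evalHom x hx)).ne_zero

theorem norm_evalHom_le_norm {g : ℤ_[p]⟦X⟧} (hg : PowerSeries.constantCoeff g = 0) :
    ‖evalHom x hx g‖ ≤ ‖x‖ := by
  obtain ⟨g', rfl⟩ := PowerSeries.X_dvd_iff.mpr hg
  rw [map_mul, evalHom_X, norm_mul]
  exact mul_le_of_le_one_right (norm_nonneg _) (norm_evalHom_le hx g')

/-- Evaluation is compatible with composition: both sides agree for polynomials, and a series
divisible by `X ^ n` changes either side by at most `‖f(x)‖ ^ n`. -/
theorem evalHom_subst (g f : ℤ_[p]⟦X⟧) (hf : PowerSeries.constantCoeff f = 0)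
    (hy : ‖evalHom x hx f‖ < 1) :
    evalHom x hx (g.subst f) = evalHom (evalHom x hx f) hy g := by
  have hs : PowerSeries.HasSubst f := PowerSeries.HasSubst.of_constantCoeff_zero' hf
  have hpoly : ∀ P : Polynomial ℤ_[p],
      evalHom x hx ((P : ℤ_[p]⟦X⟧).subst f) = evalHom _ hy P := by
    intro P
    rw [PowerSeries.subst_coe hs, evalHom_coe hy, Polynomial.aeval_def, Polynomial.hom_eval₂]
    congr 1
    ext a
    exact evalHom_C hx a
  have hdiff : ∀ n : ℕ, ‖evalHom x hx (g.subst f) - evalHom _ hy g‖ ≤ ‖evalHom x hx f‖ ^ n := by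
    intro n
    obtain ⟨r, hr⟩ : (PowerSeries.X : ℤ_[p]⟦X⟧) ^ n ∣ g - (PowerSeries.trunc n g : ℤ_[p]⟦X⟧) := by
      refine PowerSeries.X_pow_dvd_iff.mpr fun m hm => ?_
      rw [map_sub, Polynomial.coeff_coe, PowerSeries.coeff_trunc, if_pos hm, sub_self]
    rw [← sub_add_cancel g (PowerSeries.trunc n g : ℤ_[p]⟦X⟧), hr, PowerSeries.subst_add hs,
      map_add, map_add, hpoly, add_sub_add_right_eq_sub, PowerSeries.subst_mul hs,
      PowerSeries.subst_pow hs, PowerSeries.subst_X hs, map_mul, map_mul, map_pow, map_pow,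
      evalHom_X, ← mul_sub, norm_mul, norm_pow]
    refine mul_le_of_le_one_right (by positivity) ?_
    rw [sub_eq_add_neg]
    refine (IsUltrametricDist.norm_add_le_max _ _).trans (max_le (norm_evalHom_le _ _) ?_)
    rw [norm_neg]
    exact norm_evalHom_le _ _
  refine sub_eq_zero.mp (norm_le_zero_iff.mp ?_)
  exact ge_of_tendsto' (tendsto_pow_atTop_nhds_zero_of_lt_one (norm_nonneg _) hy) hdiff

theorem norm_evalCp_le (hx : ‖x‖ < 1) (g : S0 ℤ_[p]) : ‖evalCp g.1 x‖ ≤ ‖x‖ :=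
  norm_evalHom_le_norm hx g.2

theorem norm_evalCp_lt_one (hx : ‖x‖ < 1) (g : S0 ℤ_[p]) : ‖evalCp g.1 x‖ < 1 :=
  (norm_evalCp_le hx g).trans_lt hx

theorem evalCp_mul (hx : ‖x‖ < 1) (g f : S0 ℤ_[p]) :
    evalCp (g * f).1 x = evalCp g.1 (evalCp f.1 x) :=
  evalHom_subst hx g.1 f.1 f.2 (norm_evalCp_lt_one hx f)

theorem evalCp_one (hx : ‖x‖ < 1) : evalCp (1 : S0 ℤ_[p]).1 x = x := evalHom_X hx

theorem evalCp_pow_succ (hx : ‖x‖ < 1) (g : S0 ℤ_[p]) (n : ℕ) :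
    evalCp (g ^ (n + 1)).1 x = evalCp g.1 (evalCp (g ^ n).1 x) := by
  rw [pow_succ', evalCp_mul hx]

theorem evalCp_S0_zero (g : S0 ℤ_[p]) : evalCp g.1 0 = 0 := by
  rw [evalCp_zero_point, g.2, map_zero]

open scoped PowerSeries.WithPiTopology in
theorem continuous_evalCp (hx : ‖x‖ < 1) : Continuous fun g : S0 ℤ_[p] => evalCp g.1 x := by
  simp only [evalCp_eq_tsum]
  refine continuous_tsum (fun n => ?_) (summable_geometric_of_lt_one (norm_nonneg x) hx)
    fun n g => norm_intCp_mul_pow_le _ _ n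
  refine Continuous.mul ?_ continuous_const
  have h1 : Continuous (intCp : ℤ_[p] →+* ℂ_[p]) :=
    (AddMonoidHomClass.isometry_of_norm (intCp : ℤ_[p] →+* ℂ_[p]) norm_intCp).continuous
  have hval : Continuous (Subtype.val : S0 ℤ_[p] → ℤ_[p]⟦X⟧) := continuous_subtype_val
  exact h1.comp ((PowerSeries.WithPiTopology.continuous_coeff ℤ_[p] n).comp hval)

end Evaluation

/-! ### Reduction modulo `p` and Weierstrass preparation -/

/-- Reduction of the coefficients modulo `p`. -/
noncomputable abbrev red : ℤ_[p]⟦X⟧ →+* (IsLocalRing.ResidueField ℤ_[p])⟦X⟧ :=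
  PowerSeries.map (IsLocalRing.residue ℤ_[p])

theorem residue_eq_zero_iff (a : ℤ_[p]) : IsLocalRing.residue ℤ_[p] a = 0 ↔ (p : ℤ_[p]) ∣ a := by
  rw [IsLocalRing.residue_eq_zero_iff, PadicInt.maximalIdeal_eq_span_p, Ideal.mem_span_singleton]

theorem C_dvd_iff_forall_coeff {R : Type*} [CommRing R] (a : R) (g : R⟦X⟧) :
    PowerSeries.C a ∣ g ↔ ∀ n, a ∣ PowerSeries.coeff n g := by
  constructor
  · rintro ⟨v, rfl⟩ n
    rw [PowerSeries.coeff_C_mul]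
    exact dvd_mul_right _ _
  · intro h
    choose v hv using h
    exact ⟨PowerSeries.mk v, by ext n; rw [PowerSeries.coeff_C_mul, PowerSeries.coeff_mk, hv]⟩

theorem red_eq_zero_iff (g : ℤ_[p]⟦X⟧) : red g = 0 ↔ PowerSeries.C (p : ℤ_[p]) ∣ g := by
  simp only [C_dvd_iff_forall_coeff, PowerSeries.ext_iff, PowerSeries.coeff_map, map_zero,
    residue_eq_zero_iff]

theorem prime_C_p : Prime (PowerSeries.C (p : ℤ_[p])) := by
  refine ⟨?_, ?_, fun a b h => ?_⟩
  · rw [Ne, map_eq_zero_iff _ PowerSeries.C_injective]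
    exact PadicInt.prime_p.ne_zero
  · intro h
    exact PadicInt.prime_p.not_isUnit (by simpa using PowerSeries.isUnit_iff_constantCoeff.mp h)
  · simpa only [← red_eq_zero_iff, map_mul, mul_eq_zero] using h

theorem exists_eq_C_pow_mul {g : ℤ_[p]⟦X⟧} (hg : g ≠ 0) :
    ∃ (a : ℕ) (v : ℤ_[p]⟦X⟧), g = PowerSeries.C (p : ℤ_[p]) ^ a * v ∧ red v ≠ 0 := by
  have hfin : FiniteMultiplicity (PowerSeries.C (p : ℤ_[p])) g :=
    FiniteMultiplicity.of_prime_left prime_C_p hg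
  obtain ⟨v, hv, hnd⟩ := hfin.exists_eq_pow_mul_and_not_dvd
  exact ⟨_, v, hv, (red_eq_zero_iff v).not.mpr hnd⟩

theorem norm_le_inv_of_lt_one {a : ℤ_[p]} (ha : ‖a‖ < 1) : ‖a‖ ≤ (p : ℝ)⁻¹ := by
  obtain ⟨b, rfl⟩ := (PadicInt.norm_lt_one_iff_dvd a).mp ha
  rw [norm_mul, PadicInt.norm_p]
  exact mul_le_of_le_one_right (by positivity) (PadicInt.norm_le_one b)

theorem inv_p_lt_one : (p : ℝ)⁻¹ < 1 :=
  inv_lt_one_of_one_lt₀ (by exact_mod_cast (Fact.out : p.Prime).one_lt)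

/-- The roots of a distinguished polynomial lie in the open unit disc: at a point of norm at
least `1` the leading term dominates. -/
theorem norm_lt_one_of_isDistinguishedAt {P : Polynomial ℤ_[p]}
    (hP : P.IsDistinguishedAt (IsLocalRing.maximalIdeal ℤ_[p])) {x : ℂ_[p]}
    (hx : P.eval₂ intCp x = 0) : ‖x‖ < 1 := by
  by_contra! h
  rw [Polynomial.eval₂_eq_sum_range, Finset.sum_range_succ, hP.monic.coeff_natDegree, map_one,
    one_mul, add_comm, add_eq_zero_iff_eq_neg] at hx
  have h1 : ‖∑ i ∈ Finset.range P.natDegree, intCp (P.coeff i) * x ^ i‖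
      ≤ (p : ℝ)⁻¹ * ‖x‖ ^ P.natDegree := by
    refine IsUltrametricDist.norm_sum_le_of_forall_le_of_nonneg (by positivity) fun i hi => ?_
    rw [norm_mul, norm_pow, norm_intCp]
    have hi' := Finset.mem_range.mp hi
    have := hP.mem hi'
    refine mul_le_mul (norm_le_inv_of_lt_one ?_) (pow_le_pow_right₀ h hi'.le) (by positivity)
      (by positivity)
    exact PadicInt.mem_nonunits.mp ((IsLocalRing.mem_maximalIdeal _).mp this)
  have h2 : ‖x‖ ^ P.natDegree ≤ (p : ℝ)⁻¹ * ‖x‖ ^ P.natDegree := by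
    have h4 := congrArg norm hx
    rw [norm_neg, norm_pow] at h4
    exact h4.le.trans h1
  have h3 : 0 < ‖x‖ ^ P.natDegree := by positivity
  nlinarith [inv_p_lt_one (p := p)]

/-- The zeros of a power series in the open unit disc are those of its distinguished
polynomial. -/
theorem zeros_eq_of_isWeierstrassFactorization {g w : ℤ_[p]⟦X⟧} {P : Polynomial ℤ_[p]}
    (H : g.IsWeierstrassFactorization P w) :
    {x : ℂ_[p] | ‖x‖ < 1 ∧ evalCp g x = 0} = {x | P.eval₂ intCp x = 0} := by
  ext x
  simp only [Set.mem_ofPred_eq]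
  constructor
  · rintro ⟨hx, h0⟩
    rw [← evalHom_apply hx, H.eq_mul, map_mul, evalHom_coe] at h0
    exact (mul_eq_zero.mp h0).resolve_right (evalHom_ne_zero_of_isUnit hx H.isUnit)
  · intro h0
    have hx := norm_lt_one_of_isDistinguishedAt H.isDistinguishedAt h0
    refine ⟨hx, ?_⟩
    rw [← evalHom_apply hx, H.eq_mul, map_mul, evalHom_coe, h0, zero_mul]

theorem finite_zeros {g : ℤ_[p]⟦X⟧} (hg : g ≠ 0) :
    {x : ℂ_[p] | ‖x‖ < 1 ∧ evalCp g x = 0}.Finite := by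
  obtain ⟨a, v, rfl, hv⟩ := exists_eq_C_pow_mul hg
  obtain ⟨P, w, H⟩ := PowerSeries.exists_isWeierstrassFactorization hv
  have hfin : {x : ℂ_[p] | ‖x‖ < 1 ∧ evalCp v x = 0}.Finite := by
    rw [zeros_eq_of_isWeierstrassFactorization H]
    have hP : P.map intCp ≠ (0 : Polynomial ℂ_[p]) :=
      (H.isDistinguishedAt.monic.map intCp).ne_zero
    refine (Polynomial.finite_setOfPred_isRoot hP).subset fun x hx => ?_
    simpa [Polynomial.IsRoot, Polynomial.eval_map] using hx
  refine hfin.subset fun x hx => ⟨hx.1, ?_⟩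
  have h0 : evalHom x hx.1 (PowerSeries.C (p : ℤ_[p]) ^ a * v) = 0 := hx.2
  rw [map_mul, map_pow, evalHom_C] at h0
  refine (mul_eq_zero.mp h0).resolve_left (pow_ne_zero _ ?_)
  exact (map_ne_zero_iff _ intCp_injective).mpr PadicInt.prime_p.ne_zero

/-- A power series that is neither a unit nor divisible by `p` has a zero in the open unit
disc of `ℂ_p`. -/
theorem exists_zero {g : ℤ_[p]⟦X⟧} (hg : red g ≠ 0) (hu : ¬ IsUnit g) :
    ∃ x : ℂ_[p], ‖x‖ < 1 ∧ evalCp g x = 0 := by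
  obtain ⟨P, w, H⟩ := PowerSeries.exists_isWeierstrassFactorization hg
  have hdeg : P.natDegree ≠ 0 := by
    intro h
    have hP : P = 1 := H.isDistinguishedAt.monic.natDegree_eq_zero.mp h
    refine hu ?_
    rw [H.eq_mul, hP, Polynomial.coe_one, one_mul]
    exact H.isUnit
  obtain ⟨x, hx⟩ := IsAlgClosed.exists_root (P.map (intCp : ℤ_[p] →+* ℂ_[p])) (by
    rw [Polynomial.degree_eq_natDegree (H.isDistinguishedAt.monic.map _).ne_zero,
      H.isDistinguishedAt.monic.natDegree_map]
    exact_mod_cast hdeg)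
  have hmem : x ∈ {x : ℂ_[p] | ‖x‖ < 1 ∧ evalCp g x = 0} := by
    rw [zeros_eq_of_isWeierstrassFactorization H]
    simpa [Polynomial.IsRoot, Polynomial.eval_map] using hx
  exact ⟨x, hmem⟩

/-! ### Eisenstein power series -/

/-- A power series whose constant term generates the maximal ideal and which is not divisible by
`p` is, up to a unit, an Eisenstein polynomial. -/
theorem exists_irreducible_factorization {E : ℤ_[p]⟦X⟧} (hE : red E ≠ 0)
    (h0 : Irreducible (PowerSeries.constantCoeff E)) :
    ∃ (Q : Polynomial ℤ_[p]) (w : ℤ_[p]⟦X⟧), E.IsWeierstrassFactorization Q w ∧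
      Irreducible (Q.map (algebraMap ℤ_[p] ℚ_[p])) := by
  obtain ⟨Q, w, H⟩ := PowerSeries.exists_isWeierstrassFactorization hE
  refine ⟨Q, w, H, ?_⟩
  have hcc : PowerSeries.constantCoeff E = Q.coeff 0 * PowerSeries.constantCoeff w := by
    rw [H.eq_mul, map_mul, Polynomial.constantCoeff_coe]
  have hw0 : IsUnit (PowerSeries.constantCoeff w) :=
    PowerSeries.isUnit_iff_constantCoeff.mp H.isUnit
  have hQ0 : Irreducible (Q.coeff 0) := by
    rwa [hcc, irreducible_mul_isUnit hw0] at h0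
  have hdeg : 0 < Q.natDegree := by
    refine Nat.pos_of_ne_zero fun h => hQ0.not_isUnit ?_
    rw [H.isDistinguishedAt.monic.natDegree_eq_zero.mp h, Polynomial.coeff_one_zero]
    exact isUnit_one
  have heis : Q.IsEisensteinAt (IsLocalRing.maximalIdeal ℤ_[p]) := by
    refine ⟨?_, fun h => H.isDistinguishedAt.mem h, fun h => ?_⟩
    · rw [H.isDistinguishedAt.monic.leadingCoeff]
      exact (Ideal.ne_top_iff_one _).mp (Ideal.IsMaximal.ne_top inferInstance)
    · rw [hQ0.maximalIdeal_eq, Ideal.span_singleton_pow, Ideal.mem_span_singleton, sq] at h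
      obtain ⟨c, hc⟩ := h
      refine hQ0.not_isUnit (IsUnit.of_mul_eq_one c ?_)
      exact mul_left_cancel₀ hQ0.ne_zero (by rw [← mul_assoc, ← hc, mul_one])
  exact H.isDistinguishedAt.monic.irreducible_iff_irreducible_map_fraction_map.mp
    (heis.irreducible inferInstance H.isDistinguishedAt.monic.isPrimitive hdeg)

theorem aeval_map_eq_eval₂ (P : Polynomial ℤ_[p]) (x : ℂ_[p]) :
    Polynomial.aeval x (P.map (algebraMap ℤ_[p] ℚ_[p])) = P.eval₂ intCp x := by
  rw [Polynomial.aeval_def, Polynomial.eval₂_map, intCp]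

/-- An Eisenstein series divides every series that vanishes at one of its zeros, because its
distinguished polynomial is the minimal polynomial of that zero. -/
theorem dvd_of_common_zero {E G : ℤ_[p]⟦X⟧} (hE : red E ≠ 0)
    (h0 : Irreducible (PowerSeries.constantCoeff E)) {x : ℂ_[p]} (hx : ‖x‖ < 1)
    (hEx : evalCp E x = 0) (hGx : evalCp G x = 0) : E ∣ G := by
  obtain ⟨Q, w, H, hirr⟩ := exists_irreducible_factorization hE h0
  obtain ⟨q, r, hqr⟩ := PowerSeries.exists_isWeierstrassDivision G hE
  rw [← evalHom_apply hx] at hEx hGx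
  have hr : r.eval₂ intCp x = 0 := by
    rw [hqr.eq_mul_add, map_add, map_mul, hEx, zero_mul, zero_add, evalHom_coe] at hGx
    exact hGx
  have hQ : Q.eval₂ intCp x = 0 := by
    rw [H.eq_mul, map_mul, evalHom_coe] at hEx
    exact (mul_eq_zero.mp hEx).resolve_right (evalHom_ne_zero_of_isUnit hx H.isUnit)
  have hmin : Q.map (algebraMap ℤ_[p] ℚ_[p]) = minpoly ℚ_[p] x :=
    minpoly.eq_of_irreducible_of_monic hirr (by rw [aeval_map_eq_eval₂, hQ])
      (H.isDistinguishedAt.monic.map _)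
  have hinj : Function.Injective (algebraMap ℤ_[p] ℚ_[p]) := FaithfulSMul.algebraMap_injective _ _
  have hdvd : minpoly ℚ_[p] x ∣ r.map (algebraMap ℤ_[p] ℚ_[p]) :=
    minpoly.dvd _ _ (by rw [aeval_map_eq_eval₂, hr])
  have hr0 : r.map (algebraMap ℤ_[p] ℚ_[p]) = 0 := by
    refine Polynomial.eq_zero_of_dvd_of_degree_lt hdvd ?_
    rw [← hmin, Polynomial.degree_map_eq_of_injective hinj,
      Polynomial.degree_map_eq_of_injective hinj,
      Polynomial.degree_eq_natDegree H.isDistinguishedAt.monic.ne_zero,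
      H.natDegree_eq_toNat_order_map]
    exact hqr.degree_lt
  rw [Polynomial.map_eq_zero_iff hinj] at hr0
  exact ⟨q, by rw [hqr.eq_mul_add, hr0, Polynomial.coe_zero, add_zero]⟩

/-- The zeros of an Eisenstein series are simple. -/
theorem evalCp_derivative_ne_zero {E : ℤ_[p]⟦X⟧} (hE : red E ≠ 0)
    (h0 : Irreducible (PowerSeries.constantCoeff E)) {x : ℂ_[p]} (hx : ‖x‖ < 1)
    (hEx : evalCp E x = 0) : evalCp (PowerSeries.derivative ℤ_[p] E) x ≠ 0 := by
  obtain ⟨Q, w, H, hirr⟩ := exists_irreducible_factorization hE h0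
  rw [← evalHom_apply hx] at hEx ⊢
  have hQ : Q.eval₂ intCp x = 0 := by
    rw [H.eq_mul, map_mul, evalHom_coe] at hEx
    exact (mul_eq_zero.mp hEx).resolve_right (evalHom_ne_zero_of_isUnit hx H.isUnit)
  have hQ' := hirr.separable.aeval_derivative_ne_zero
    (show Polynomial.aeval x (Q.map (algebraMap ℤ_[p] ℚ_[p])) = 0 by rw [aeval_map_eq_eval₂, hQ])
  rw [Polynomial.derivative_map, aeval_map_eq_eval₂] at hQ'
  rw [H.eq_mul, Derivation.leibniz, PowerSeries.derivative_coe, map_add, smul_eq_mul, smul_eq_mul,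
    map_mul, map_mul, evalHom_coe, evalHom_coe, hQ, zero_mul, zero_add]
  exact mul_ne_zero (evalHom_ne_zero_of_isUnit hx H.isUnit) hQ'

/-- An Eisenstein series has as many zeros as the order of its reduction. -/
theorem ncard_zeros {E : ℤ_[p]⟦X⟧} (hE : red E ≠ 0)
    (h0 : Irreducible (PowerSeries.constantCoeff E)) :
    {x : ℂ_[p] | ‖x‖ < 1 ∧ evalCp E x = 0}.ncard = (red E).order.toNat := by
  obtain ⟨Q, w, H, hirr⟩ := exists_irreducible_factorization hE h0
  rw [zeros_eq_of_isWeierstrassFactorization H, ← H.natDegree_eq_toNat_order_map]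
  have h1 : {x : ℂ_[p] | Q.eval₂ intCp x = 0} =
      (Q.map (algebraMap ℤ_[p] ℚ_[p])).rootSet ℂ_[p] := by
    ext x
    rw [Polynomial.mem_rootSet_of_ne hirr.ne_zero, aeval_map_eq_eval₂, Set.mem_ofPred_eq]
  rw [h1, ← Nat.card_coe_set_eq, Nat.card_eq_fintype_card,
    Polynomial.card_rootSet_eq_natDegree hirr.separable (IsAlgClosed.splits _),
    H.isDistinguishedAt.monic.natDegree_map]

/-! ### Counting the points of a fibre -/

section Ultrametric

variable {K : Type*} [NormedField K]

theorem summable_mul_pow [CompleteSpace K] {c : ℕ → K} (hc : ∀ i, ‖c i‖ ≤ 1) {x : K}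
    (hx : ‖x‖ < 1) :
    Summable fun i => c i * x ^ i := by
  refine Summable.of_norm_bounded (summable_geometric_of_lt_one (norm_nonneg x) hx) fun n => ?_
  rw [norm_mul, norm_pow]
  exact mul_le_of_le_one_left (by positivity) (hc n)

theorem norm_tsum_mul_pow_le [IsUltrametricDist K] {c : ℕ → K} (hc : ∀ i, ‖c i‖ ≤ 1) {x : K}
    (hx : ‖x‖ < 1) :
    ‖∑' i, c i * x ^ i‖ ≤ 1 := by
  refine IsUltrametricDist.norm_tsum_le_of_forall_le_of_nonneg zero_le_one fun n => ?_
  rw [norm_mul, norm_pow]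
  exact mul_le_one₀ (hc n) (by positivity) (pow_le_one₀ (norm_nonneg _) hx.le)

theorem tsum_mul_pow_eq_add [CompleteSpace K] {c : ℕ → K} (hc : ∀ i, ‖c i‖ ≤ 1) {x : K}
    (hx : ‖x‖ < 1) :
    ∑' i, c i * x ^ i = c 0 + x * ∑' i, c (i + 1) * x ^ i := by
  rw [(summable_mul_pow hc hx).tsum_eq_zero_add, pow_zero, mul_one, ← tsum_mul_left]
  congr 1
  exact tsum_congr fun i => by ring

/-- A power series with coefficients of norm at most `1` whose first coefficient of norm `1` is
the `d`-th has at most `d` zeros in the open unit disc: dividing by `X - r` for a zero `r` lowers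
`d` by one. -/
theorem card_le_of_zeros [IsUltrametricDist K] [CompleteSpace K] (d : ℕ) (c : ℕ → K)
    (S : Finset K) (hc : ∀ i, ‖c i‖ ≤ 1) (hlt : ∀ i < d, ‖c i‖ < 1) (hd : ‖c d‖ = 1)
    (hS : ∀ x ∈ S, ‖x‖ < 1 ∧ ∑' i, c i * x ^ i = 0) : S.card ≤ d := by
  classical
  induction d generalizing c S with
  | zero =>
    rw [Nat.le_zero, Finset.card_eq_zero, Finset.eq_empty_iff_forall_notMem]
    intro x hxS
    obtain ⟨hx, h0⟩ := hS x hxS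
    rw [tsum_mul_pow_eq_add hc hx, add_eq_zero_iff_eq_neg] at h0
    rw [h0, norm_neg, norm_mul] at hd
    have := norm_tsum_mul_pow_le (fun i => hc (i + 1)) hx
    nlinarith [norm_nonneg x]
  | succ d ih =>
    obtain rfl | ⟨r, hr⟩ := S.eq_empty_or_nonempty
    · simp
    obtain ⟨hr1, hr0⟩ := hS r hr
    -- the coefficients of the quotient by `X - r`
    set b : ℕ → K := fun j => ∑' i, c (i + j + 1) * r ^ i with hb
    have hb1 : ∀ j, ‖b j‖ ≤ 1 := fun j => norm_tsum_mul_pow_le (fun i => hc _) hr1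
    have hrec : ∀ j, b j = c (j + 1) + r * b (j + 1) := fun j => by
      simp only [hb]
      rw [tsum_mul_pow_eq_add (fun i => hc (i + j + 1)) hr1, zero_add]
      congr 2
      exact tsum_congr fun i => by congr 2; ring
    have hrb : ∀ j, ‖r * b j‖ < 1 := fun j => by
      rw [norm_mul]
      exact (mul_le_of_le_one_right (norm_nonneg r) (hb1 j)).trans_lt hr1
    have hcard := ih b (S.erase r) hb1 (fun j hj => by
        rw [hrec]
        exact (IsUltrametricDist.norm_add_le_max _ _).trans_lt
          (max_lt (hlt _ (by omega)) (hrb _)))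
      (by
        rw [hrec, IsUltrametricDist.norm_add_eq_max_of_norm_ne_norm
          (by rw [hd]; exact (hrb _).ne'), hd]
        exact max_eq_left (hrb _).le)
      (fun x hx => by
        obtain ⟨hxr, hxS⟩ := Finset.mem_erase.mp hx
        obtain ⟨hx1, hx0⟩ := hS x hxS
        refine ⟨hx1, ?_⟩
        have h1 : ∑' i, c (i + 1) * x ^ i =
            ∑' i, b i * x ^ i - r * ∑' i, b (i + 1) * x ^ i := by
          rw [← tsum_mul_left, ← (summable_mul_pow hb1 hx1).tsum_sub
            ((summable_mul_pow (fun i => hb1 (i + 1)) hx1).mul_left r)]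
          refine tsum_congr fun i => ?_
          rw [hrec i]
          ring
        have h2 : c 0 + r * b 0 = 0 := by
          rw [← hr0, tsum_mul_pow_eq_add hc hr1]
        have h3 := tsum_mul_pow_eq_add hb1 hx1
        rw [tsum_mul_pow_eq_add hc hx1, h1] at hx0
        have h4 : (x - r) * ∑' i, b i * x ^ i = 0 := by
          linear_combination hx0 - h2 - r * h3
        exact (mul_eq_zero.mp h4).resolve_left (sub_ne_zero.mpr hxr))
    rw [Finset.card_erase_of_mem hr] at hcard
    omega

end Ultrametric

/-- A power series of Weierstrass degree `d` takes each value of the open unit disc at most `d`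
times there. -/
theorem card_fibre_le {g : ℤ_[p]⟦X⟧} {d : ℕ} (hd0 : d ≠ 0) (hd : (red g).order = d) {y : ℂ_[p]}
    (hy : ‖y‖ < 1) (S : Finset ℂ_[p]) (hS : ∀ x ∈ S, ‖x‖ < 1 ∧ evalCp g x = y) :
    S.card ≤ d := by
  obtain ⟨hne, hz⟩ := PowerSeries.order_eq_nat.mp hd
  have hlt : ∀ i < d, ‖PowerSeries.coeff i g‖ < 1 := fun i hi => by
    have := hz i hi
    rw [PowerSeries.coeff_map, residue_eq_zero_iff] at this
    exact (PadicInt.norm_lt_one_iff_dvd _).mpr this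
  have hone : ‖PowerSeries.coeff d g‖ = 1 := by
    rw [PowerSeries.coeff_map, Ne, residue_eq_zero_iff, ← PadicInt.norm_lt_one_iff_dvd,
      not_lt] at hne
    exact le_antisymm (PadicInt.norm_le_one _) hne
  have hsub : ∀ i, ‖intCp (PowerSeries.coeff i g) - (if i = 0 then y else 0)‖ ≤
      max ‖PowerSeries.coeff i g‖ (if i = 0 then ‖y‖ else 0) := fun i => by
    rw [sub_eq_add_neg, ← norm_intCp]
    refine (IsUltrametricDist.norm_add_le_max _ _).trans (max_le_max le_rfl ?_)
    rw [norm_neg]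
    split_ifs <;> simp
  refine card_le_of_zeros d (fun i => intCp (PowerSeries.coeff i g) - if i = 0 then y else 0) S
    (fun i => (hsub i).trans (max_le (PadicInt.norm_le_one _) ?_))
    (fun i hi => (hsub i).trans_lt (max_lt (hlt i hi) ?_)) ?_ fun x hx => ⟨(hS x hx).1, ?_⟩
  · split_ifs
    exacts [hy.le, zero_le_one]
  · split_ifs
    exacts [hy, zero_lt_one]
  · simp only [if_neg hd0, sub_zero, norm_intCp, hone]
  · obtain ⟨hx1, hxy⟩ := hS x hx
    simp only [sub_mul]
    rw [(summable_norm_intCp_mul_pow g hx1).of_norm.tsum_sub, ← evalCp_eq_tsum, hxy,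
      tsum_eq_single 0]
    · simp
    · intro i hi
      simp [hi]
    · refine summable_of_ne_finset_zero (s := {0}) fun i hi => ?_
      rw [Finset.mem_singleton] at hi
      simp [hi]

/-! ### Composition, linear coefficients and uniqueness of commuting series -/

section Composition

variable {R : Type*} [CommRing R]

/-- The quotient `f(X) / X`; the constant term of `f` is discarded. -/
noncomputable def divX (f : R⟦X⟧) : R⟦X⟧ := PowerSeries.mk fun n => PowerSeries.coeff (n + 1) f

theorem X_mul_divX (f : S0 R) : f.1 = PowerSeries.X * divX f.1 := by
  have := PowerSeries.eq_X_mul_shift_add_const f.1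
  rwa [f.2, map_zero, add_zero] at this

theorem constantCoeff_divX (f : R⟦X⟧) :
    PowerSeries.constantCoeff (divX f) = PowerSeries.coeff 1 f := by
  rw [← PowerSeries.coeff_zero_eq_constantCoeff_apply, divX, PowerSeries.coeff_mk]

theorem constantCoeff_subst_S0 (g : R⟦X⟧) (f : S0 R) :
    PowerSeries.constantCoeff (g.subst f.1) = PowerSeries.constantCoeff g := by
  rw [← PowerSeries.coeff_zero_eq_constantCoeff_apply, S0.coeff_subst_eq_sum]
  simp

theorem coeff_one_mul_of_constantCoeff {a : R⟦X⟧} (ha : PowerSeries.constantCoeff a = 0)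
    (b : R⟦X⟧) :
    PowerSeries.coeff 1 (a * b) = PowerSeries.coeff 1 a * PowerSeries.constantCoeff b := by
  rw [PowerSeries.coeff_one_mul, ha, mul_zero, add_zero]

/-- The linear coefficient is multiplicative for composition. -/
noncomputable def linearCoeff : S0 R →* R where
  toFun g := PowerSeries.coeff 1 g.1
  map_one' := by rw [S0.val_one, PowerSeries.coeff_one_X]
  map_mul' f g := by
    rw [S0.val_mul, S0.coeff_subst_eq_sum]
    simp [Finset.sum_range_succ, f.2]

theorem linearCoeff_apply (g : S0 R) : linearCoeff g = PowerSeries.coeff 1 g.1 := rfl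

theorem C_dvd_pow_sub_X {a : R} {u : S0 R} (h : PowerSeries.C a ∣ u.1 - PowerSeries.X) (N : ℕ) :
    PowerSeries.C a ∣ (u ^ N).1 - PowerSeries.X := by
  induction N with
  | zero => rw [pow_zero, S0.val_one, sub_self]; exact dvd_zero _
  | succ N ih =>
    obtain ⟨b, hb⟩ := ih
    have h1 : (u ^ (N + 1)).1 - PowerSeries.X =
        PowerSeries.C a * b.subst u.1 + (u.1 - PowerSeries.X) := by
      have h2 := congrArg (PowerSeries.subst u.1) hb
      rw [PowerSeries.subst_sub u.hasSubst, PowerSeries.subst_X u.hasSubst,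
        ← PowerSeries.smul_eq_C_mul, PowerSeries.subst_smul u.hasSubst,
        PowerSeries.smul_eq_C_mul] at h2
      rw [pow_succ, S0.val_mul, ← h2]
      ring
    rw [h1]
    exact dvd_add (dvd_mul_right _ _) h

/-- A series with linear coefficient `1` commuting with `f` is the identity, unless the linear
coefficient of `f` is zero or a root of unity: compare the coefficients of `f ∘ u` and `u ∘ f` in
the lowest degree in which `u` differs from `X`. -/
theorem eq_one_of_commute [IsDomain R] {f u : S0 R} (hcomm : f * u = u * f)
    (hf0 : linearCoeff f ≠ 0) (hf1 : ∀ n : ℕ, n ≠ 0 → linearCoeff f ^ n ≠ 1)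
    (hu : linearCoeff u = 1) : u = 1 := by
  by_contra hne
  have hex : ∃ n, PowerSeries.coeff n (u.1 - PowerSeries.X) ≠ 0 := by
    by_contra! h
    exact hne (Subtype.ext (sub_eq_zero.mp (PowerSeries.ext h)))
  classical
  obtain ⟨hn, hmin⟩ : PowerSeries.coeff (Nat.find hex) (u.1 - PowerSeries.X) ≠ 0 ∧
      ∀ m < Nat.find hex, PowerSeries.coeff m (u.1 - PowerSeries.X) = 0 :=
    ⟨Nat.find_spec hex, fun m hm => not_not.mp (Nat.find_min hex hm)⟩
  generalize Nat.find hex = n at hn hmin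
  obtain ⟨w, hw⟩ := PowerSeries.X_pow_dvd_iff.mpr hmin
  have hu' : u.1 = PowerSeries.X + PowerSeries.X ^ n * w := by rw [← hw]; ring
  have hn2 : 2 ≤ n := by
    by_contra! h
    interval_cases n
    · exact hn (by simp [u.2])
    · exact hn (by rw [map_sub, ← linearCoeff_apply, hu, PowerSeries.coeff_one_X, sub_self])
  have hw0 : PowerSeries.coeff n (u.1 - PowerSeries.X) = PowerSeries.constantCoeff w := by
    rw [hw]
    simpa using PowerSeries.coeff_X_pow_mul w n 0
  rw [hw0] at hn
  set b := PowerSeries.constantCoeff w with hb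
  have hXf : ∀ g : S0 R, PowerSeries.X ∣ g.1 := fun g => PowerSeries.X_dvd_iff.mpr g.2
  -- the coefficient of `X ^ n` in `f ∘ u - f`
  have hleft : PowerSeries.coeff n (f * u).1 = PowerSeries.coeff n f.1 + linearCoeff f * b := by
    have hpow : ∀ i, PowerSeries.coeff n (u.1 ^ i) =
        PowerSeries.coeff n (PowerSeries.X ^ i : R⟦X⟧) + if i = 1 then b else 0 := by
      intro i
      rw [← sub_eq_iff_eq_add', ← map_sub]
      obtain _ | _ | i := i
      · simp
      · simpa using hw0
      · rw [if_neg (by omega)]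
        have hdvd : (PowerSeries.X : R⟦X⟧) ^ (n + 1) ∣ u.1 ^ (i + 2) - PowerSeries.X ^ (i + 2) := by
          have h3 : u.1 ^ (i + 2) - PowerSeries.X ^ (i + 2) =
              (u.1 ^ (i + 1) - PowerSeries.X ^ (i + 1)) * u.1 +
                (u.1 - PowerSeries.X) * PowerSeries.X * PowerSeries.X ^ i := by ring
          have h4 : (PowerSeries.X : R⟦X⟧) ^ n ∣ u.1 - PowerSeries.X := ⟨w, hw⟩
          rw [h3, pow_succ]
          exact dvd_add (mul_dvd_mul (h4.trans (sub_dvd_pow_sub_pow _ _ _)) (hXf u))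
            ((mul_dvd_mul_right h4 _).trans (dvd_mul_right _ _))
        exact PowerSeries.X_pow_dvd_iff.mp hdvd n (Nat.lt_succ_self n)
    have hfX := S0.coeff_subst_eq_sum f.1 (1 : S0 R) n
    rw [S0.val_one, PowerSeries.X_subst] at hfX
    rw [S0.val_mul, S0.coeff_subst_eq_sum, hfX]
    simp only [hpow, mul_add, Finset.sum_add_distrib, mul_ite, mul_zero]
    rw [Finset.sum_ite_eq' (Finset.range (n + 1)) 1, if_pos (by simp; omega), linearCoeff_apply]
  -- the coefficient of `X ^ n` in `u ∘ f - f`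
  have hright : PowerSeries.coeff n (u * f).1 =
      PowerSeries.coeff n f.1 + linearCoeff f ^ n * b := by
    rw [S0.val_mul, hu', PowerSeries.subst_add f.hasSubst, PowerSeries.subst_mul f.hasSubst,
      PowerSeries.subst_pow f.hasSubst, PowerSeries.subst_X f.hasSubst, map_add]
    congr 1
    conv_lhs => rw [X_mul_divX f, mul_pow, mul_assoc]
    have := PowerSeries.coeff_X_pow_mul (divX f.1 ^ n * w.subst (PowerSeries.X * divX f.1)) n 0
    rw [zero_add] at this
    rw [this, ← X_mul_divX f, PowerSeries.coeff_zero_eq_constantCoeff_apply, map_mul, map_pow,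
      constantCoeff_divX, constantCoeff_subst_S0, linearCoeff_apply]
  rw [hcomm, hright, add_left_cancel_iff] at hleft
  have h1 : linearCoeff f ^ n = linearCoeff f := mul_right_cancel₀ hn hleft
  obtain ⟨m, rfl⟩ : ∃ m, n = m + 1 := ⟨n - 1, by omega⟩
  rw [pow_succ] at h1
  exact hf1 m (by omega) (mul_right_cancel₀ hf0 (by rw [h1, one_mul]))

end Composition

/-! ### Series of height one and their iterates -/

/-- `f'(0)` is a uniformizer of `ℤ_p` and `f` has Weierstrass degree `p`. -/
structure IsHeightOne (f : S0 ℤ_[p]) : Prop where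
  norm_linearCoeff : ‖linearCoeff f‖ = (p : ℝ)⁻¹
  order_red : (red f.1).order = p

theorem irreducible_of_norm_eq {a : ℤ_[p]} (ha : ‖a‖ = (p : ℝ)⁻¹) : Irreducible a := by
  obtain ⟨b, rfl⟩ := (PadicInt.norm_lt_one_iff_dvd a).mp (ha ▸ inv_p_lt_one)
  have hp : (p : ℝ)⁻¹ ≠ 0 :=
    inv_ne_zero (by exact_mod_cast (Fact.out : p.Prime).ne_zero)
  rw [norm_mul, PadicInt.norm_p] at ha
  have hb : IsUnit b := PadicInt.isUnit_iff.mpr (mul_left_cancel₀ hp (by rw [ha, mul_one]))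
  exact (irreducible_mul_isUnit hb).mpr PadicInt.irreducible_p

theorem evalCp_eq_mul_divX (f : S0 ℤ_[p]) {x : ℂ_[p]} (hx : ‖x‖ < 1) :
    evalCp f.1 x = x * evalCp (divX f.1) x := by
  rw [← evalHom_apply hx, ← evalHom_apply hx]
  conv_lhs => rw [X_mul_divX f]
  rw [map_mul, evalHom_X]

/-- Having `p` zeros in the open unit disc forces Weierstrass degree `p`, since `f(X) / X` is an
Eisenstein series and so its zeros are simple. -/
theorem isHeightOne_of_ncard_zeros {f : S0 ℤ_[p]}
    (hf : (PowerSeries.coeff 1 f.1).valuation = 1)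
    (hroots : {x : ℂ_[p] | ‖x‖ < 1 ∧ evalCp f.1 x = 0}.ncard = p) : IsHeightOne f := by
  have hne : linearCoeff f ≠ 0 := fun h => by
    rw [linearCoeff_apply] at h
    rw [h, PadicInt.valuation_zero] at hf
    exact zero_ne_one hf
  have hnorm : ‖linearCoeff f‖ = (p : ℝ)⁻¹ := by
    rw [PadicInt.norm_eq_zpow_neg_valuation hne, linearCoeff_apply, hf]
    simp
  have hirr := irreducible_of_norm_eq hnorm
  have hzero : ∀ x : ℂ_[p], ‖x‖ < 1 → (evalCp f.1 x = 0 ↔ x = 0 ∨ evalCp (divX f.1) x = 0) := by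
    intro x hx
    rw [evalCp_eq_mul_divX f hx, mul_eq_zero]
  have h0 : evalCp (divX f.1) (0 : ℂ_[p]) ≠ 0 := by
    rw [evalCp_zero_point, constantCoeff_divX]
    exact (map_ne_zero_iff _ intCp_injective).mpr hne
  have hset : {x : ℂ_[p] | ‖x‖ < 1 ∧ evalCp f.1 x = 0} =
      insert 0 {x : ℂ_[p] | ‖x‖ < 1 ∧ evalCp (divX f.1) x = 0} := by
    ext x
    simp only [Set.mem_ofPred_eq, Set.mem_insert_iff]
    constructor
    · rintro ⟨hx, h⟩
      exact ((hzero x hx).mp h).imp id fun h => ⟨hx, h⟩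
    · rintro (rfl | ⟨hx, h⟩)
      · exact ⟨by simp, evalCp_S0_zero f⟩
      · exact ⟨hx, (hzero x hx).mpr (Or.inr h)⟩
  have hdiv : divX f.1 ≠ 0 := fun h => hne (by
    rw [linearCoeff_apply, ← constantCoeff_divX, h, map_zero])
  rw [hset, Set.ncard_insert_of_notMem (fun h => h0 h.2) (finite_zeros hdiv)] at hroots
  have hred : red (divX f.1) ≠ 0 := by
    intro h
    obtain ⟨v, hv⟩ := (red_eq_zero_iff _).mp h
    have hv0 : IsUnit v := by
      rw [PowerSeries.isUnit_iff_constantCoeff]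
      have h1 : linearCoeff f = p * PowerSeries.constantCoeff v := by
        rw [linearCoeff_apply, ← constantCoeff_divX, hv, map_mul, PowerSeries.constantCoeff_C]
      rw [h1] at hirr
      exact (hirr.isUnit_or_isUnit rfl).resolve_left PadicInt.prime_p.not_isUnit
    have hempty : {x : ℂ_[p] | ‖x‖ < 1 ∧ evalCp (divX f.1) x = 0} = ∅ := by
      refine Set.eq_empty_of_forall_notMem fun x ⟨hx, h⟩ => ?_
      rw [← evalHom_apply hx, hv, map_mul, evalHom_C] at h
      exact mul_ne_zero ((map_ne_zero_iff _ intCp_injective).mpr PadicInt.prime_p.ne_zero)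
        (evalHom_ne_zero_of_isUnit hx hv0) h
    rw [hempty, Set.ncard_empty] at hroots
    exact (Fact.out : p.Prime).one_lt.ne hroots
  rw [ncard_zeros hred (by rwa [constantCoeff_divX])] at hroots
  refine ⟨hnorm, ?_⟩
  rw [X_mul_divX f, map_mul, PowerSeries.map_X, PowerSeries.order_mul, PowerSeries.order_X,
    ← ENat.natCast_toNat (PowerSeries.order_finite_iff_ne_zero.mpr hred).ne, add_comm]
  exact_mod_cast hroots

/-- The `n`-th Eisenstein factor `h(f^{∘n})` with `h = f(X) / X`, for which
`f^{∘(n+1)} = f^{∘n} * h(f^{∘n})`. Its zeros are the points reaching `0` after exactly `n + 1`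
iterations of `f`. -/
noncomputable def eisensteinFactor (f : S0 ℤ_[p]) (n : ℕ) : ℤ_[p]⟦X⟧ :=
  (divX f.1).subst (f ^ n).1

theorem val_pow_succ (f : S0 ℤ_[p]) (n : ℕ) :
    (f ^ (n + 1)).1 = (f ^ n).1 * eisensteinFactor f n := by
  have h : (f ^ (n + 1)).1 = PowerSeries.subst (f ^ n).1 f.1 := by rw [pow_succ', S0.val_mul]
  rw [h, X_mul_divX f, PowerSeries.subst_mul (f ^ n).hasSubst,
    PowerSeries.subst_X (f ^ n).hasSubst, eisensteinFactor]

theorem constantCoeff_eisensteinFactor (f : S0 ℤ_[p]) (n : ℕ) :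
    PowerSeries.constantCoeff (eisensteinFactor f n) = linearCoeff f := by
  rw [eisensteinFactor, constantCoeff_subst_S0, constantCoeff_divX, linearCoeff_apply]

theorem evalCp_eisensteinFactor (f : S0 ℤ_[p]) (n : ℕ) {x : ℂ_[p]} (hx : ‖x‖ < 1) :
    evalCp (eisensteinFactor f n) x = evalCp (divX f.1) (evalCp (f ^ n).1 x) :=
  evalHom_subst hx _ _ (f ^ n).2 (norm_evalCp_lt_one hx _)

namespace IsHeightOne

variable {f : S0 ℤ_[p]} (hf : IsHeightOne f)
include hf

theorem irreducible : Irreducible (linearCoeff f) := irreducible_of_norm_eq hf.norm_linearCoeff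

theorem irreducible_constantCoeff (n : ℕ) :
    Irreducible (PowerSeries.constantCoeff (eisensteinFactor f n)) := by
  rw [constantCoeff_eisensteinFactor]
  exact hf.irreducible

theorem exists_eq_X_pow_mul_add :
    ∃ w b : ℤ_[p]⟦X⟧, IsUnit w ∧ f.1 = PowerSeries.X ^ p * w + PowerSeries.C (p : ℤ_[p]) * b := by
  obtain ⟨hne, hlt⟩ := PowerSeries.order_eq_nat.mp hf.order_red
  obtain ⟨w', hw'⟩ := PowerSeries.X_pow_dvd_iff.mpr hlt
  obtain ⟨w, rfl⟩ := PowerSeries.map_surjective _ IsLocalRing.residue_surjective w'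
  obtain ⟨b, hb⟩ := (red_eq_zero_iff (f.1 - PowerSeries.X ^ p * w)).mp (by
    rw [map_sub, map_mul, map_pow, PowerSeries.map_X, hw', sub_self])
  refine ⟨w, b, ?_, by rw [← hb]; ring⟩
  rw [hw'] at hne
  have h1 := PowerSeries.coeff_X_pow_mul (red w) p 0
  rw [zero_add] at h1
  rw [h1, PowerSeries.coeff_map, PowerSeries.coeff_zero_eq_constantCoeff_apply, Ne,
    IsLocalRing.residue_eq_zero_iff, IsLocalRing.mem_maximalIdeal, mem_nonunits_iff, not_not] at hne
  exact PowerSeries.isUnit_iff_constantCoeff.mpr hne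

theorem order_red_pow (n : ℕ) : (red (f ^ n).1).order = ((p ^ n : ℕ) : ℕ∞) := by
  obtain ⟨w, b, hw, hfw⟩ := hf.exists_eq_X_pow_mul_add
  induction n with
  | zero => rw [pow_zero, S0.val_one, PowerSeries.map_X, PowerSeries.order_X]; simp
  | succ n ih =>
    have hs := (f ^ n).hasSubst
    have h1 : (f ^ (n + 1)).1 = (f ^ n).1 ^ p * w.subst (f ^ n).1 +
        PowerSeries.C (p : ℤ_[p]) * b.subst (f ^ n).1 := by
      rw [pow_succ', S0.val_mul, hfw, PowerSeries.subst_add hs, PowerSeries.subst_mul hs,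
        PowerSeries.subst_pow hs, PowerSeries.subst_X hs, ← PowerSeries.smul_eq_C_mul,
        PowerSeries.subst_smul hs, PowerSeries.smul_eq_C_mul]
    have hw' : IsUnit (red (w.subst (f ^ n).1)) := by
      refine IsUnit.map _ (PowerSeries.isUnit_iff_constantCoeff.mpr ?_)
      rw [constantCoeff_subst_S0]
      exact PowerSeries.isUnit_iff_constantCoeff.mp hw
    rw [h1, map_add, (red_eq_zero_iff _).mpr (dvd_mul_right _ _), add_zero, map_mul, map_pow,
      PowerSeries.order_mul, PowerSeries.order_pow, ih, PowerSeries.order_zero_of_unit hw']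
    push_cast
    ring

theorem red_pow_ne_zero (n : ℕ) : red (f ^ n).1 ≠ 0 := by
  rw [← PowerSeries.order_finite_iff_ne_zero, hf.order_red_pow]
  exact ENat.natCast_lt_top _

theorem red_eisensteinFactor_ne_zero (n : ℕ) : red (eisensteinFactor f n) ≠ 0 := by
  intro h
  refine hf.red_pow_ne_zero (n + 1) ?_
  rw [val_pow_succ, map_mul, h, mul_zero]

theorem norm_evalCp_lt {x : ℂ_[p]} (hx : ‖x‖ < 1) (hx0 : x ≠ 0) : ‖evalCp f.1 x‖ < ‖x‖ := by
  rw [evalCp_eq_mul_divX f hx, norm_mul]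
  refine mul_lt_of_lt_one_right (norm_pos_iff.mpr hx0) (norm_evalHom_lt_one hx ?_)
  rw [constantCoeff_divX, ← linearCoeff_apply, hf.norm_linearCoeff]
  exact inv_p_lt_one

/-- An infinite `f`-orbit cannot be contained in the zero set of a nonzero series, so a zero set
stable under `f` consists of points that some iterate of `f` sends to `0`. -/
theorem exists_iterate_eq_zero {G : ℤ_[p]⟦X⟧} (hG : G ≠ 0) {x : ℂ_[p]} (hx : ‖x‖ < 1)
    (h : ∀ n, evalCp G (evalCp (f ^ n).1 x) = 0) : ∃ n, evalCp (f ^ n).1 x = 0 := by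
  by_contra! hne
  have hanti : StrictAnti fun n => ‖evalCp (f ^ n).1 x‖ := strictAnti_nat_of_succ_lt fun n => by
    rw [evalCp_pow_succ hx]
    exact hf.norm_evalCp_lt (norm_evalCp_lt_one hx _) (hne n)
  have hinj : Function.Injective fun n => evalCp (f ^ n).1 x := fun a b hab =>
    hanti.injective (congrArg norm hab)
  exact Set.infinite_of_injective_forall_mem
    (s := {x : ℂ_[p] | ‖x‖ < 1 ∧ evalCp G x = 0}) hinj
    (fun n => ⟨norm_evalCp_lt_one hx _, h n⟩) (finite_zeros hG)

end IsHeightOne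

/-! ### Towers of preimages of `0` and divisibility -/

/-- A nontrivial `f`-consistent sequence, indexed by `ℕ` by putting `0` in front. -/
structure IsTower (f : S0 ℤ_[p]) (σ : ℕ → ℂ_[p]) : Prop where
  zero : σ 0 = 0
  one_ne_zero : σ 1 ≠ 0
  norm_lt_one : ∀ n, ‖σ n‖ < 1
  eval_succ : ∀ n, evalCp f.1 (σ (n + 1)) = σ n

namespace IsTower

variable {f : S0 ℤ_[p]} {σ : ℕ → ℂ_[p]} (hσ : IsTower f σ)
include hσ

theorem evalCp_pow (m n : ℕ) : evalCp (f ^ m).1 (σ (n + m)) = σ n := by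
  induction m generalizing n with
  | zero => exact evalCp_one (hσ.norm_lt_one _)
  | succ m ih =>
    rw [evalCp_pow_succ (hσ.norm_lt_one _), show n + (m + 1) = n + 1 + m by ring, ih,
      hσ.eval_succ]

theorem ne_zero (n : ℕ) : σ (n + 1) ≠ 0 := by
  intro h
  have := hσ.evalCp_pow n 1
  rw [add_comm 1 n, h, evalCp_S0_zero] at this
  exact hσ.one_ne_zero this.symm

theorem evalCp_eisensteinFactor_eq_zero (n : ℕ) :
    evalCp (eisensteinFactor f n) (σ (n + 1)) = 0 := by
  have h1 := hσ.evalCp_pow n 1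
  rw [add_comm] at h1
  rw [evalCp_eisensteinFactor f n (hσ.norm_lt_one _), h1]
  have h2 := hσ.eval_succ 0
  rw [hσ.zero, zero_add, evalCp_eq_mul_divX f (hσ.norm_lt_one _)] at h2
  exact (mul_eq_zero.mp h2).resolve_left hσ.one_ne_zero

theorem evalCp_eq_self_of_le {g : S0 ℤ_[p]} (hg : f * g = g * f) {m n : ℕ} (hmn : m ≤ n)
    (h : evalCp g.1 (σ n) = σ n) : evalCp g.1 (σ m) = σ m := by
  obtain ⟨i, rfl⟩ := Nat.exists_eq_add_of_le hmn
  have hc : f ^ i * g = g * f ^ i := (Commute.pow_left hg i : _)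
  rw [← hσ.evalCp_pow i m, ← evalCp_mul (hσ.norm_lt_one _), ← hc, evalCp_mul (hσ.norm_lt_one _), h]

variable (hf : IsHeightOne f)
include hf

theorem injective : Function.Injective σ := by
  refine Function.Injective.of_comp (f := norm) (StrictMono.injective (strictMono_nat_of_lt_succ
    fun n => ?_))
  rw [Function.comp_apply, Function.comp_apply, ← hσ.eval_succ n]
  exact hf.norm_evalCp_lt (hσ.norm_lt_one _) (hσ.ne_zero n)

/-- A series vanishing on the first `n + 1` points of a tower is divisible by `f^{∘n}`: the
Eisenstein factors of `f^{∘n}` are minimal for those points. -/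
theorem pow_dvd {G : ℤ_[p]⟦X⟧} (n : ℕ) (hG : ∀ j ≤ n, evalCp G (σ j) = 0) : (f ^ n).1 ∣ G := by
  induction n with
  | zero =>
    have h0 := hG 0 le_rfl
    rw [hσ.zero, evalCp_zero_point, map_eq_zero_iff _ intCp_injective] at h0
    rw [pow_zero, S0.val_one]
    exact PowerSeries.X_dvd_iff.mpr h0
  | succ n ih =>
    obtain ⟨w, rfl⟩ := ih fun j hj => hG j (hj.trans n.le_succ)
    have hx := hσ.norm_lt_one (n + 1)
    have h1 := hG (n + 1) le_rfl
    rw [← evalHom_apply hx, map_mul, evalHom_apply, evalHom_apply, add_comm n 1,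
      hσ.evalCp_pow n 1, add_comm 1 n] at h1
    rw [val_pow_succ]
    exact mul_dvd_mul_left _ (dvd_of_common_zero (hf.red_eisensteinFactor_ne_zero n)
      (hf.irreducible_constantCoeff n) hx (hσ.evalCp_eisensteinFactor_eq_zero n)
      ((mul_eq_zero.mp h1).resolve_left hσ.one_ne_zero))

omit hf in
theorem evalCp_sub_X_eq_zero {g : S0 ℤ_[p]} (hg : f * g = g * f) {n : ℕ}
    (h : evalCp g.1 (σ n) = σ n) : ∀ j ≤ n, evalCp (g.1 - PowerSeries.X) (σ j) = 0 := by
  intro j hj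
  rw [← evalHom_apply (hσ.norm_lt_one j), map_sub, evalHom_X, evalHom_apply,
    hσ.evalCp_eq_self_of_le hg hj h, sub_self]

/-- A series fixing all points of a tower is the identity. -/
theorem eq_one_of_fixed {g : S0 ℤ_[p]} (h : ∀ n, evalCp g.1 (σ n) = σ n) : g = 1 := by
  by_contra hne
  have hG : g.1 - PowerSeries.X ≠ 0 := fun h0 => hne (Subtype.ext (sub_eq_zero.mp h0))
  refine Set.infinite_of_injective_forall_mem
    (s := {x : ℂ_[p] | ‖x‖ < 1 ∧ evalCp (g.1 - PowerSeries.X) x = 0}) (hσ.injective hf)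
    (fun n => ⟨hσ.norm_lt_one n, ?_⟩) (finite_zeros hG)
  rw [← evalHom_apply (hσ.norm_lt_one n), map_sub, evalHom_X, evalHom_apply, h, sub_self]

end IsTower

/-! ### Fixed points of the commuting series -/

theorem IsHeightOne.norm_coeff_one {f : S0 ℤ_[p]} (hf : IsHeightOne f) (a n : ℕ)
    (w : ℤ_[p]⟦X⟧) :
    ‖PowerSeries.coeff 1 (PowerSeries.C (p : ℤ_[p]) ^ a * ((f ^ n).1 * w))‖ =
      (p : ℝ)⁻¹ ^ (a + n) * ‖PowerSeries.constantCoeff w‖ := by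
  rw [← map_pow, PowerSeries.coeff_C_mul, coeff_one_mul_of_constantCoeff (f ^ n).2,
    ← linearCoeff_apply, map_pow, norm_mul, norm_mul, norm_pow, norm_pow, PadicInt.norm_p,
    hf.norm_linearCoeff]
  ring

theorem linearCoeff_ne_one {f u : S0 ℤ_[p]} (hf : IsHeightOne f) (hcomm : f * u = u * f)
    (hu : u ≠ 1) : linearCoeff u ≠ 1 := by
  refine fun h => hu (eq_one_of_commute hcomm hf.irreducible.ne_zero (fun n hn h1 => ?_) h)
  have h2 := congrArg norm h1
  rw [norm_pow, hf.norm_linearCoeff, norm_one] at h2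
  exact (pow_lt_one₀ (by positivity) inv_p_lt_one hn).ne h2

/-- A nonzero point `x` that some iterate of `f` sends to `0` cannot be a double zero of `u - X`
unless `u'(0) = 1`: it is a simple zero of `F = f^{∘(j+1)}`, and the chain rule for
`F ∘ u = u ∘ F` at `x` reads `F'(x) = u'(0) F'(x)`. -/
theorem linearCoeff_eq_one_of_derivative {f u : S0 ℤ_[p]} (hf : IsHeightOne f)
    (hcomm : f * u = u * f) {x : ℂ_[p]} (hx : ‖x‖ < 1) {j : ℕ}
    (hj : evalCp (f ^ j).1 x ≠ 0) (hj' : evalCp (f ^ (j + 1)).1 x = 0)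
    (hux : evalCp u.1 x = x) (hu' : evalCp (PowerSeries.derivative ℤ_[p] u.1) x = 1) :
    linearCoeff u = 1 := by
  set F := f ^ (j + 1) with hF
  have hE : evalCp (eisensteinFactor f j) x = 0 := by
    rw [hF, val_pow_succ, ← evalHom_apply hx, map_mul] at hj'
    exact (mul_eq_zero.mp hj').resolve_left hj
  have hF' : evalCp (PowerSeries.derivative ℤ_[p] F.1) x ≠ 0 := by
    rw [hF, val_pow_succ, ← evalHom_apply hx, Derivation.leibniz, map_add, smul_eq_mul,
      smul_eq_mul, map_mul, map_mul, evalHom_apply hx (eisensteinFactor f j), hE, zero_mul,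
      add_zero]
    exact mul_ne_zero hj (evalCp_derivative_ne_zero (hf.red_eisensteinFactor_ne_zero j)
      (hf.irreducible_constantCoeff j) hx hE)
  have hc : F * u = u * F := (Commute.pow_left hcomm (j + 1) : _)
  have hd := congrArg (fun g : S0 ℤ_[p] => evalCp (PowerSeries.derivative ℤ_[p] g.1) x) hc
  simp only [S0.val_mul] at hd
  rw [PowerSeries.derivative_subst u.hasSubst, PowerSeries.derivative_subst F.hasSubst,
    ← evalHom_apply hx, map_mul, ← evalHom_apply hx, map_mul,
    evalHom_subst hx _ _ u.2 (norm_evalCp_lt_one hx u),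
    evalHom_subst hx _ _ F.2 (norm_evalCp_lt_one hx F)] at hd
  simp only [evalHom_apply, hux, hu', hj', evalCp_zero_point] at hd
  have h0 : PowerSeries.constantCoeff (PowerSeries.derivative ℤ_[p] u.1) = linearCoeff u := by
    rw [← PowerSeries.coeff_zero_eq_constantCoeff_apply, PowerSeries.coeff_derivative,
      linearCoeff_apply]
    simp
  rw [h0, mul_one] at hd
  have h1 : intCp (linearCoeff u) = (1 : ℂ_[p]) :=
    mul_right_cancel₀ hF' (by rw [← hd, one_mul])
  exact intCp_injective (by rw [h1, map_one])

section Fixed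

variable {f u : S0 ℤ_[p]} {σ : ℕ → ℂ_[p]} (hf : IsHeightOne f) (hσ : IsTower f σ)
  (hcomm : f * u = u * f)
include hf hσ hcomm

/-- If `u ≠ 1` fixes the points of a tower exactly up to level `k`, then
`u - X = p ^ a * f^{∘k} * unit` for some `a`; comparing linear coefficients,
`|u'(0) - 1| = |p| ^ (a + k)`. -/
theorem exists_norm_linearCoeff_sub_one (hu : u ≠ 1) {k : ℕ}
    (hk : evalCp u.1 (σ k) = σ k) (hk' : evalCp u.1 (σ (k + 1)) ≠ σ (k + 1)) :
    ∃ a : ℕ, PowerSeries.C ((p : ℤ_[p]) ^ a) ∣ u.1 - PowerSeries.X ∧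
      ‖linearCoeff u - 1‖ = (p : ℝ)⁻¹ ^ (a + k) := by
  have hu1 := linearCoeff_ne_one hf hcomm hu
  have hG : u.1 - PowerSeries.X ≠ 0 := fun h0 => hu (Subtype.ext (sub_eq_zero.mp h0))
  obtain ⟨a, v, hav, hv⟩ := exists_eq_C_pow_mul hG
  have hp0 : (intCp (p : ℤ_[p]) : ℂ_[p]) ≠ 0 :=
    (map_ne_zero_iff _ intCp_injective).mpr PadicInt.prime_p.ne_zero
  obtain ⟨w, rfl⟩ : (f ^ k).1 ∣ v := hσ.pow_dvd hf k fun j hj => by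
    have h1 := hσ.evalCp_sub_X_eq_zero hcomm hk j hj
    have hx := hσ.norm_lt_one j
    rw [hav, ← evalHom_apply hx, map_mul, map_pow, evalHom_C] at h1
    exact (mul_eq_zero.mp h1).resolve_left (pow_ne_zero _ hp0)
  have hlin : linearCoeff u - 1 = PowerSeries.coeff 1 (u.1 - PowerSeries.X) := by
    rw [map_sub, PowerSeries.coeff_one_X, linearCoeff_apply]
  have hnorm : ‖linearCoeff u - 1‖ =
      (p : ℝ)⁻¹ ^ (a + k) * ‖PowerSeries.constantCoeff w‖ := by
    rw [hlin, hav, hf.norm_coeff_one]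
  refine ⟨a, by rw [hav, map_pow]; exact dvd_mul_right _ _, ?_⟩
  suffices hw : IsUnit w by
    rw [hnorm, PadicInt.isUnit_iff.mp (PowerSeries.isUnit_iff_constantCoeff.mp hw), mul_one]
  by_contra hw
  have hredw : red w ≠ 0 := fun h => hv (by rw [map_mul, h, mul_zero])
  obtain ⟨x, hx, hwx⟩ := exists_zero hredw hw
  have hux : evalCp u.1 x = x := by
    have h1 := congrArg (evalHom x hx) hav
    rw [map_mul, map_mul, evalHom_apply hx w, hwx, mul_zero, mul_zero, map_sub, evalHom_X] at h1
    exact sub_eq_zero.mp h1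
  -- the fixed points of `u` are stable under `f`
  have hex : ∃ n, evalCp (f ^ n).1 x = 0 := by
    refine hf.exists_iterate_eq_zero hG hx fun n => ?_
    have hc : f ^ n * u = u * f ^ n := (Commute.pow_left hcomm n : _)
    rw [← evalHom_apply (norm_evalCp_lt_one hx _), map_sub, evalHom_X, evalHom_apply,
      ← evalCp_mul hx, ← hc, evalCp_mul hx, hux, sub_self]
  classical
  obtain ⟨hi, hmin⟩ : evalCp (f ^ Nat.find hex).1 x = 0 ∧
      ∀ m < Nat.find hex, evalCp (f ^ m).1 x ≠ 0 :=
    ⟨Nat.find_spec hex, fun m hm => Nat.find_min hex hm⟩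
  generalize Nat.find hex = i at hi hmin
  obtain _ | j := i
  · -- `x = 0` is a double zero of `u - X`
    rw [pow_zero, evalCp_one hx] at hi
    rw [hi, evalCp_zero_point, map_eq_zero_iff _ intCp_injective] at hwx
    rw [hwx, norm_zero, mul_zero, norm_eq_zero, sub_eq_zero] at hnorm
    exact hu1 hnorm
  · have hj := hmin j (Nat.lt_succ_self j)
    have hE : evalCp (eisensteinFactor f j) x = 0 := by
      rw [val_pow_succ, ← evalHom_apply hx, map_mul] at hi
      exact (mul_eq_zero.mp hi).resolve_left hj
    obtain hkj | hjk := le_or_gt k j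
    · -- `x` is conjugate to `σ (j + 1)`, which `u` would then fix
      obtain ⟨q, hq⟩ := dvd_of_common_zero (hf.red_eisensteinFactor_ne_zero j)
        (hf.irreducible_constantCoeff j) (G := u.1 - PowerSeries.X) hx hE (by
          rw [← evalHom_apply hx, map_sub, evalHom_X, evalHom_apply, hux, sub_self])
      have hx' := hσ.norm_lt_one (j + 1)
      have h1 := congrArg (evalHom _ hx') hq
      rw [map_mul, evalHom_apply hx' (eisensteinFactor f j),
        hσ.evalCp_eisensteinFactor_eq_zero, zero_mul, map_sub, evalHom_X] at h1
      exact hk' (hσ.evalCp_eq_self_of_le hcomm (Nat.succ_le_succ hkj) (sub_eq_zero.mp h1))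
    · -- `x` is a zero of both `f^{∘k}` and `w`, hence a double zero of `u - X`
      have hFk : evalHom x hx (f ^ k).1 = 0 := by
        obtain ⟨m, rfl⟩ := Nat.exists_eq_add_of_le (Nat.succ_le_iff.mpr hjk)
        rw [Nat.succ_eq_add_one, add_comm, pow_add, evalHom_apply, evalCp_mul hx, hi,
          evalCp_S0_zero]
      refine hu1 (linearCoeff_eq_one_of_derivative hf hcomm hx hj hi hux ?_)
      have h1 := congrArg (fun g => evalHom x hx (PowerSeries.derivative ℤ_[p] g)) hav
      simp only [map_sub, PowerSeries.derivative_X, Derivation.leibniz, smul_eq_mul, map_add,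
        map_mul, hFk, evalHom_apply hx w, hwx, zero_mul, mul_zero, add_zero, map_one] at h1
      exact sub_eq_zero.mp h1

/-- The key estimate: if `u` fixes the points of a tower exactly up to level `k` and satisfies the
valuation condition on `1 - u'(0) ^ m`, then an iterate `u^{∘N}` fixing the point of level `k + m`
has `p ^ m ∣ N`. -/
theorem pow_dvd_of_fixed (hu : u ≠ 1) {k : ℕ}
    (hk : evalCp u.1 (σ k) = σ k) (hk' : evalCp u.1 (σ (k + 1)) ≠ σ (k + 1))
    (hval : ∀ m : ℕ, ‖1 - linearCoeff u ^ m‖ = ‖1 - linearCoeff u‖ * ‖(m : ℤ_[p])‖)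
    {N m : ℕ} (hN : evalCp (u ^ N).1 (σ (k + m)) = σ (k + m)) : p ^ m ∣ N := by
  obtain ⟨a, ha, hnorm⟩ := exists_norm_linearCoeff_sub_one hf hσ hcomm hu hk hk'
  have hc : f * u ^ N = u ^ N * f := (Commute.pow_right hcomm N : _)
  obtain ⟨w, hw⟩ := hσ.pow_dvd hf (k + m) (hσ.evalCp_sub_X_eq_zero hc hN)
  have hpw : PowerSeries.C (p : ℤ_[p]) ^ a ∣ w := by
    refine prime_C_p.pow_dvd_of_dvd_mul_left a (a := (f ^ (k + m)).1) ?_ ?_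
    · rw [← red_eq_zero_iff]
      exact hf.red_pow_ne_zero _
    · rw [← hw, ← map_pow]
      exact C_dvd_pow_sub_X ha N
  obtain ⟨w', rfl⟩ := hpw
  have hle : ‖1 - linearCoeff u ^ N‖ ≤ (p : ℝ)⁻¹ ^ (a + (k + m)) := by
    have h1 : linearCoeff u ^ N - 1 = PowerSeries.coeff 1 ((u ^ N).1 - PowerSeries.X) := by
      rw [map_sub, PowerSeries.coeff_one_X, ← linearCoeff_apply, map_pow]
    rw [norm_sub_rev, h1, hw, mul_left_comm, hf.norm_coeff_one]
    exact mul_le_of_le_one_right (by positivity) (PadicInt.norm_le_one _)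
  have hp : (0 : ℝ) < (p : ℝ)⁻¹ := by
    have := (Fact.out : p.Prime).pos
    positivity
  rw [hval, norm_sub_rev, hnorm, ← add_assoc, pow_add _ (a + k) m] at hle
  have h2 := le_of_mul_le_mul_left hle (by positivity)
  have h3 : ‖((N : ℤ) : ℤ_[p])‖ ≤ (p : ℝ) ^ (-m : ℤ) := by
    simpa [zpow_neg, inv_pow] using h2
  exact_mod_cast PadicInt.norm_int_le_pow_iff_dvd.mp h3

end Fixed

/-- The iterates of `u` move the point of level `k + m` transitively through its fibre: they reach
at least `p ^ m` points, and `f^{∘m}` has Weierstrass degree `p ^ m`. -/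
theorem exists_pow_eq {f : S0 ℤ_[p]} {u : (S0 ℤ_[p])ˣ} {σ : ℕ → ℂ_[p]} (hf : IsHeightOne f)
    (hσ : IsTower f σ) (hcomm : f * u.1 = u.1 * f) (hu : u.1 ≠ 1) {k : ℕ}
    (hk : evalCp u.1.1 (σ k) = σ k) (hk' : evalCp u.1.1 (σ (k + 1)) ≠ σ (k + 1))
    (hval : ∀ m : ℕ, ‖1 - linearCoeff u.1 ^ m‖ = ‖1 - linearCoeff u.1‖ * ‖(m : ℤ_[p])‖)
    (m : ℕ) {t : ℂ_[p]} (ht : ‖t‖ < 1) (htk : evalCp (f ^ m).1 t = σ k) :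
    ∃ i : ℕ, evalCp (u.1 ^ i).1 (σ (k + m)) = t := by
  classical
  by_contra! hne
  have hx := hσ.norm_lt_one (k + m)
  have hmono : ∀ i j : ℕ, i ≤ j →
      evalCp (u.1 ^ i).1 (σ (k + m)) = evalCp (u.1 ^ j).1 (σ (k + m)) → p ^ m ∣ j - i := by
    intro i j hij h
    obtain ⟨d, rfl⟩ := Nat.exists_eq_add_of_le hij
    rw [Nat.add_sub_cancel_left]
    refine pow_dvd_of_fixed hf hσ hcomm hu hk hk' hval ?_
    have h1 := congrArg (evalCp ((u⁻¹ ^ i : (S0 ℤ_[p])ˣ) : S0 ℤ_[p]).1) h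
    rw [← evalCp_mul hx, ← evalCp_mul hx, pow_add, ← mul_assoc, ← Units.val_pow_eq_pow_val u i,
      ← Units.val_mul, inv_pow, inv_mul_cancel, Units.val_one, one_mul, evalCp_one hx] at h1
    exact h1.symm
  have hinj : Set.InjOn (fun i => evalCp (u.1 ^ i).1 (σ (k + m))) (Finset.range (p ^ m)) := by
    intro i hi j hj h
    have hi' := Finset.mem_range.mp hi
    have hj' := Finset.mem_range.mp hj
    obtain hij | hij := le_total i j
    · have := Nat.eq_zero_of_dvd_of_lt (hmono i j hij h) (by omega)
      omega
    · have := Nat.eq_zero_of_dvd_of_lt (hmono j i hij h.symm) (by omega)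
      omega
  have hfix : ∀ i, evalCp (u.1 ^ i).1 (σ k) = σ k := fun i => by
    induction i with
    | zero => exact evalCp_one (hσ.norm_lt_one k)
    | succ i ih => rw [evalCp_pow_succ (hσ.norm_lt_one k), ih, hk]
  have hcard := card_fibre_le (pow_ne_zero m (Fact.out : p.Prime).ne_zero) (hf.order_red_pow m)
    (hσ.norm_lt_one k)
    (insert t ((Finset.range (p ^ m)).image fun i => evalCp (u.1 ^ i).1 (σ (k + m)))) (by
      intro x hxS
      obtain rfl | hxS := Finset.mem_insert.mp hxS
      · exact ⟨ht, htk⟩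
      · obtain ⟨i, -, rfl⟩ := Finset.mem_image.mp hxS
        refine ⟨norm_evalCp_lt_one hx _, ?_⟩
        have hc : f ^ m * u.1 ^ i = u.1 ^ i * f ^ m := (Commute.pow_pow hcomm m i : _)
        rw [← evalCp_mul hx, hc, evalCp_mul hx, hσ.evalCp_pow, hfix])
  rw [Finset.card_insert_of_notMem (by
      rw [Finset.mem_image]
      rintro ⟨i, -, h⟩
      exact hne i h), Finset.card_image_of_injOn hinj, Finset.card_range] at hcard
  omega

/-! ### The closed subgroup generated by `u` and its action -/

section Topology

open scoped PowerSeries.WithPiTopology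

variable {R : Type*} [CommRing R] [TopologicalSpace R]

instance [T2Space R] : T2Space (S0 R) :=
  inferInstanceAs (T2Space {g : R⟦X⟧ // PowerSeries.constantCoeff g = 0})

instance [T1Space R] [CompactSpace R] : CompactSpace (S0 R) := by
  have : CompactSpace R⟦X⟧ := inferInstanceAs (CompactSpace ((Unit →₀ ℕ) → R))
  have hclosed : IsClosed {g : R⟦X⟧ | PowerSeries.constantCoeff g = 0} :=
    isClosed_singleton.preimage (PowerSeries.WithPiTopology.continuous_constantCoeff R)
  exact isCompact_iff_compactSpace.mp hclosed.isCompact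

end Topology

theorem commute_of_mem_closure {f : S0 ℤ_[p]} {u g : (S0 ℤ_[p])ˣ} (hcomm : f * u.1 = u.1 * f)
    (hg : g ∈ (Subgroup.zpowers u).topologicalClosure) : f * g.1 = g.1 * f := by
  have hclosed : IsClosed {g : (S0 ℤ_[p])ˣ | f * g.1 = g.1 * f} :=
    isClosed_eq (continuous_const.mul Units.continuous_val)
      (Units.continuous_val.mul continuous_const)
  refine closure_minimal (fun g hg => ?_) hclosed hg
  obtain ⟨n, rfl⟩ := Subgroup.mem_zpowers_iff.mp hg
  exact Commute.units_zpow_right hcomm n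

theorem fixed_of_mem_closure {u g : (S0 ℤ_[p])ˣ} {x : ℂ_[p]} (hx : ‖x‖ < 1)
    (hux : evalCp u.1.1 x = x) (hg : g ∈ (Subgroup.zpowers u).topologicalClosure) :
    evalCp g.1.1 x = x := by
  have hclosed : IsClosed {g : (S0 ℤ_[p])ˣ | evalCp g.1.1 x = x} :=
    isClosed_eq ((continuous_evalCp hx).comp Units.continuous_val) continuous_const
  refine closure_minimal (fun g hg => ?_) hclosed hg
  have hinv : evalCp (u⁻¹).1.1 x = x := by
    conv_lhs => rw [← hux]
    rw [← evalCp_mul hx, Units.inv_mul, evalCp_one hx]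
  have hpow : ∀ v : (S0 ℤ_[p])ˣ, evalCp v.1.1 x = x → ∀ n : ℕ, evalCp (v ^ n).1.1 x = x := by
    intro v hv n
    induction n with
    | zero => exact evalCp_one hx
    | succ n ih => rw [pow_succ', Units.val_mul, evalCp_mul hx, ih, hv]
  obtain ⟨n, rfl⟩ := Subgroup.mem_zpowers_iff.mp hg
  obtain ⟨n, rfl | rfl⟩ := n.eq_nat_or_neg
  · exact (zpow_natCast u n).symm ▸ hpow u hux n
  · rw [Set.mem_ofPred_eq, zpow_neg, zpow_natCast, ← inv_pow]
    exact hpow _ hinv n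

/-- By compactness of the closed subgroup generated by `u`, a sequence that can be reached from `x`
by powers of `u` up to every finite level is reached by one element of that subgroup. -/
theorem exists_mem_closure_forall_eq {u : (S0 ℤ_[p])ˣ} {x y : ℕ → ℂ_[p]} (hx : ∀ n, ‖x n‖ < 1)
    (h : ∀ n, ∃ i : ℕ, ∀ j ≤ n, evalCp (u.1 ^ i).1 (x j) = y j) :
    ∃ g ∈ (Subgroup.zpowers u).topologicalClosure, ∀ n, evalCp g.1.1 (x n) = y n := by
  set Z : ℕ → Set (S0 ℤ_[p])ˣ := fun n =>
    {g | g ∈ (Subgroup.zpowers u).topologicalClosure ∧ ∀ j ≤ n, evalCp g.1.1 (x j) = y j} with hZ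
  have hclosed : ∀ n, IsClosed (Z n) := fun n => by
    have hZn : Z n = ((Subgroup.zpowers u).topologicalClosure : Set (S0 ℤ_[p])ˣ) ∩
        ⋂ j, ⋂ (_ : j ≤ n), {g | evalCp g.1.1 (x j) = y j} := by
      ext g
      simp only [hZ, Set.mem_ofPred_eq, Set.mem_inter_iff, Set.mem_iInter, SetLike.mem_coe]
    rw [hZn]
    exact (Subgroup.isClosed_topologicalClosure _).inter <|
      isClosed_iInter fun j => isClosed_iInter fun _ =>
      isClosed_eq ((continuous_evalCp (hx j)).comp Units.continuous_val) continuous_const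
  obtain ⟨g, hg⟩ := IsCompact.nonempty_iInter_of_sequence_nonempty_isCompact_isClosed Z
    (fun n g hg => ⟨hg.1, fun j hj => hg.2 j (hj.trans n.le_succ)⟩)
    (fun n => by
      obtain ⟨i, hi⟩ := h n
      refine ⟨u ^ i, Subgroup.le_topologicalClosure _ (Subgroup.npow_mem_zpowers u i), ?_⟩
      simpa only [Units.val_pow_eq_pow_val] using hi)
    (hclosed 0).isCompact hclosed
  rw [Set.mem_iInter] at hg
  exact ⟨g, (hg 0).1, fun n => (hg n).2 n le_rfl⟩

/-! ### Consistent sequences as towers -/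

/-- The sequence `(0, s₁, s₂, …)`. -/
noncomputable def prependZero (s : ℕ+ → ℂ_[p]) : ℕ → ℂ_[p]
  | 0 => 0
  | n + 1 => s n.succPNat

theorem prependZero_coe (s : ℕ+ → ℂ_[p]) (i : ℕ+) : prependZero s i = s i := by
  obtain ⟨n, rfl⟩ : ∃ n : ℕ, i = n.succPNat := ⟨i.natPred, (PNat.succPNat_natPred i).symm⟩
  rfl

theorem isTower_prependZero {f : S0 ℤ_[p]} {s : ℕ+ → ℂ_[p]} (hs : IsConsistent f.1 s)
    (h1 : s 1 ≠ 0) : IsTower f (prependZero s) where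
  zero := rfl
  one_ne_zero := h1
  norm_lt_one n := by
    cases n with
    | zero => simp [prependZero]
    | succ n => exact hs.norm_lt_one _
  eval_succ n := by
    cases n with
    | zero => exact hs.eval_one
    | succ n => exact hs.eval_succ n.succPNat

theorem isConsistent_evalCp {f g : S0 ℤ_[p]} (hg : f * g = g * f) {s : ℕ+ → ℂ_[p]}
    (hs : IsConsistent f.1 s) : IsConsistent f.1 fun i => evalCp g.1 (s i) where
  norm_lt_one i := norm_evalCp_lt_one (hs.norm_lt_one i) g
  eval_one := by
    rw [← evalCp_mul (hs.norm_lt_one 1), hg, evalCp_mul (hs.norm_lt_one 1), hs.eval_one,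
      evalCp_S0_zero]
  eval_succ i := by
    rw [← evalCp_mul (hs.norm_lt_one _), hg, evalCp_mul (hs.norm_lt_one _), hs.eval_succ]

end PadicDynamics

open PadicDynamics in
theorem proposition2p7 (p : ℕ) [Fact p.Prime]
    (f : S0 ℤ_[p]) (u : (S0 ℤ_[p])ˣ)
    -- `f ∘ u = u ∘ f`
    (hcomm : f * (u : S0 ℤ_[p]) = (u : S0 ℤ_[p]) * f)
    -- `u` has infinite order
    (hu : ¬ IsOfFinOrder u)
    -- `v_p(f'(0)) = 1`, and `f` has exactly `p` roots in the open unit disc of `ℂ_p`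
    (hf : (PowerSeries.coeff 1 f.1).valuation = 1)
    (hroots : {x : ℂ_[p] | ‖x‖ < 1 ∧ evalCp f.1 x = 0}.ncard = p)
    -- `v_p(1 - u'(0)^m) = v_p(1 - u'(0)) + v_p(m)` for all `m`, written with absolute values
    (hval : ∀ m : ℕ, ‖1 - PowerSeries.coeff 1 u.1.1 ^ m‖ =
      ‖1 - PowerSeries.coeff 1 u.1.1‖ * ‖(m : ℤ_[p])‖)
    -- the fixed `f`-consistent sequence `(π₁, π₂, …)`, with `π₁ ≠ 0`
    (π : ℕ+ → ℂ_[p]) (hπ : IsConsistent f.1 π) (hπ_ne : π 1 ≠ 0) :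
    -- there is a largest `k` with `u(π_k) = π_k`, and the coordinatewise action of the
    -- closed subgroup generated by `u` is a torsor
    ∃ k : ℕ+, IsGreatest {n : ℕ+ | evalCp u.1.1 (π n) = π n} k ∧
      ∃ _ : Torsor (Subgroup.zpowers u).topologicalClosure (consistentAgreeing f.1 π k),
        ∀ (g : (Subgroup.zpowers u).topologicalClosure) (s : consistentAgreeing f.1 π k)
          (i : ℕ+), (g • s).1 i = evalCp g.1.1.1 (s.1 i) := by
  have hf1 : IsHeightOne f := isHeightOne_of_ncard_zeros hf hroots
  have hu1 : u.1 ≠ 1 := fun h => hu (by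
    rw [Units.val_eq_one] at h
    exact h ▸ IsOfFinOrder.one)
  have hσ := isTower_prependZero hπ hπ_ne
  set σ := prependZero π with hσdef
  have hex : ∃ n, evalCp u.1.1 (σ n) ≠ σ n := by
    by_contra! h
    exact hu1 (hσ.eq_one_of_fixed hf1 h)
  classical
  obtain ⟨k, hk, hk'⟩ : ∃ k, evalCp u.1.1 (σ k) = σ k ∧ evalCp u.1.1 (σ (k + 1)) ≠ σ (k + 1) := by
    have h0 : Nat.find hex ≠ 0 := fun h => by
      have := Nat.find_spec hex
      rw [h, hσ.zero] at this
      exact this (evalCp_S0_zero _)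
    obtain ⟨k, hk⟩ := Nat.exists_eq_succ_of_ne_zero h0
    exact ⟨k, not_not.mp (Nat.find_min hex (by omega)), by
      have := Nat.find_spec hex
      rwa [hk] at this⟩
  have htrans := fun m t => exists_pow_eq hf1 hσ hcomm hu1 hk hk' hval m (t := t)
  -- if `u` moved `π₁`, its powers would move `π₁` to the zero `0` of `f`
  have hk0 : k ≠ 0 := by
    rintro rfl
    obtain ⟨i, hi⟩ := htrans 1 0 (by simp) (by rw [evalCp_S0_zero, hσ.zero])
    have hx := hσ.norm_lt_one (0 + 1)
    have h1 := congrArg (evalCp ((u ^ i)⁻¹ : (S0 ℤ_[p])ˣ).1.1) hi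
    rw [← Units.val_pow_eq_pow_val, ← evalCp_mul hx, Units.inv_mul, evalCp_one hx,
      evalCp_S0_zero] at h1
    exact hσ.ne_zero 0 h1
  lift k to ℕ+ using Nat.pos_of_ne_zero hk0
  refine ⟨k, ⟨?_, fun n hn => ?_⟩, ?_⟩
  · simpa only [Set.mem_ofPred_eq, hσdef, prependZero_coe] using hk
  · by_contra! hlt
    refine hk' (hσ.evalCp_eq_self_of_le hcomm (n := n) ?_ ?_)
    · exact Nat.succ_le_iff.mpr (PNat.coe_lt_coe _ _ |>.mpr hlt)
    · simpa only [Set.mem_ofPred_eq, hσdef, prependZero_coe] using hn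
  have hfix : ∀ i ≤ k, evalCp u.1.1 (π i) = π i := fun i hi => by
    have := hσ.evalCp_eq_self_of_le hcomm (PNat.coe_le_coe _ _ |>.mpr hi) hk
    rwa [hσdef, prependZero_coe] at this
  let act : MulAction (Subgroup.zpowers u).topologicalClosure (consistentAgreeing f.1 π k) :=
    { smul := fun g s => ⟨fun i => evalCp g.1.1.1 (s.1 i),
        isConsistent_evalCp (commute_of_mem_closure hcomm g.2) s.2.1, fun i hi => by
          dsimp only
          rw [s.2.2 i hi]
          exact fixed_of_mem_closure (hπ.norm_lt_one i) (hfix i hi) g.2⟩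
      one_smul := fun s => Subtype.ext (funext fun i => evalCp_one (s.2.1.norm_lt_one i))
      mul_smul := fun g h s => Subtype.ext (funext fun i =>
        evalCp_mul (s.2.1.norm_lt_one i) g.1.1 h.1.1) }
  have hsmul : ∀ (g : (Subgroup.zpowers u).topologicalClosure) (s : consistentAgreeing f.1 π k)
      (i : ℕ+), (g • s).1 i = evalCp g.1.1.1 (s.1 i) := fun _ _ _ => rfl
  have hbase : π ∈ consistentAgreeing f.1 π k := ⟨hπ, fun _ _ => rfl⟩
  have htower : ∀ s : consistentAgreeing f.1 π k, IsTower f (prependZero s.1) := fun s =>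
    isTower_prependZero s.2.1 (by rw [s.2.2 1 one_le]; exact hπ_ne)
  have hfree : ∀ (g : (Subgroup.zpowers u).topologicalClosure) (s : consistentAgreeing f.1 π k),
      g • s = s → g = 1 := by
    intro g s h
    refine Subtype.ext (Units.ext ((htower s).eq_one_of_fixed hf1 fun n => ?_))
    cases n with
    | zero => exact evalCp_S0_zero _
    | succ n => exact (hsmul g s _).symm.trans (congrArg (fun s => s.1 n.succPNat) h)
  have hreach : ∀ s : consistentAgreeing f.1 π k,
      ∃ g : (Subgroup.zpowers u).topologicalClosure,
        g • (⟨π, hbase⟩ : consistentAgreeing f.1 π k) = s := by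
    intro s
    have hs := htower s
    obtain ⟨g, hg, hgs⟩ := exists_mem_closure_forall_eq (u := u) (x := σ) (y := prependZero s.1)
      hσ.norm_lt_one fun n => by
        have hsk : prependZero s.1 k = σ k := by
          rw [hσdef, prependZero_coe, prependZero_coe, s.2.2 k le_rfl]
        obtain ⟨i, hi⟩ := htrans n (prependZero s.1 (k + n)) (hs.norm_lt_one _)
          (by rw [hs.evalCp_pow, hsk])
        refine ⟨i, fun j hj => ?_⟩
        obtain ⟨d, hd⟩ := Nat.exists_eq_add_of_le (hj.trans (Nat.le_add_left n k))
        have hx := hσ.norm_lt_one (k + n)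
        have hc : f ^ d * u.1 ^ i = u.1 ^ i * f ^ d := (Commute.pow_pow hcomm d i : _)
        rw [← hs.evalCp_pow d j, ← hσ.evalCp_pow d j, ← hd, ← hi, ← evalCp_mul hx, ← hc,
          evalCp_mul hx]
    refine ⟨⟨g, hg⟩, Subtype.ext (funext fun i => ?_)⟩
    have := hgs i
    rwa [hσdef, prependZero_coe, prependZero_coe] at this
  have hpre : ∀ s t : consistentAgreeing f.1 π k,
      ∃ g : (Subgroup.zpowers u).topologicalClosure, g • t = s := by
    intro s t
    obtain ⟨g, hg⟩ := hreach s
    obtain ⟨h, hh⟩ := hreach t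
    exact ⟨g * h⁻¹, by rw [mul_smul, ← hh, inv_smul_smul, hg]⟩
  choose d hd using hpre
  exact ⟨{ act with
    sdiv := d
    nonempty := ⟨⟨π, hbase⟩⟩
    sdiv_smul' := hd
    smul_sdiv' := fun g s => by
      have h1 : (g⁻¹ * d (g • s) s) • s = s := by rw [mul_smul, hd, inv_smul_smul]
      exact (inv_mul_eq_one.mp (hfree _ _ h1)).symm }, hsmul⟩
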